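/- All algebras are over $\mathbb C$, $\odot$ is the algebraic tensor product, $\iota$ is the identity map and $A'$ is the space of all linear functionals on $A$. An associative, possibly non-unital algebra $A$ is non-degenerate if $ab=0$ for all $b$ implies $a=0$, and $ba=0$ for all $b$ implies $a=0$; $M(A)$ denotes its multiplier algebra, i.e. the unital algebra of pairs $m=(L,R)$ of linear maps $A\to A$ with $R(x)y=xL(y)$ for all $x,y\in A$, written $mx=L(x)$, $xm=R(x)$, in which $A$ is embedded by left and right multiplications. A regular multiplier Hopf algebra is a non-degenerate algebra $A$ with a homomorphism $\Delta:A\to M(A\odot A)$ which is non-degenerate (both $\Delta(A)(A\odot A)$ and $(A\odot A)\Delta(A)$ span $A\odot A$) and coassociative, $(\Delta\odot\iota)\Delta=(\iota\odot\Delta)\Delta$, and such that the linear maps determined by $a\otimes b\mapsto\Delta(a)(b\otimes1),\ \Delta(a)(1\otimes b),\ (b\otimes1)\Delta(a),\ (1\otimes b)\Delta(a)$ are bijections from $A\odot A$ onto $A\odot A\subseteq M(A\odot A)$. For $\omega\in A'$ and $a\in A$, the multiplier $(\omega\odot\iota)\Delta(a)\in M(A)$ is given by $[(\omega\odot\iota)\Delta(a)]b=(\omega\odot\iota)(\Delta(a)(1\otimes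 b))$ and $b[(\omega\odot\iota)\Delta(a)]=(\omega\odot\iota)((1\otimes b)\Delta(a))$; similarly, $(\iota\odot\omega)\Delta(a)\in M(A)$ is given by $[(\iota\odot\omega)\Delta(a)]b=(\iota\odot\omega)(\Delta(a)(b\otimes1))$ and $b[(\iota\odot\omega)\Delta(a)]=(\iota\odot\omega)((b\otimes1)\Delta(a))$. A counit is a non-zero homomorphism $\varepsilon:A\to\mathbb C$ with $(\varepsilon\odot\iota)\Delta(a)=(\iota\odot\varepsilon)\Delta(a)=a$ for all $a\in A$. An algebraic quantum group is a regular multiplier Hopf algebra for which there is a non-zero $\varphi\in A'$ that is left invariant: $(\iota\odot\varphi)\Delta(a)=\varphi(a)1$ for all $a\in A$. Its dual is $\hat A=\{\varphi(a\,\cdot\,)\mid a\in A\}\subseteq A'$ with the product $(\omega_1\omega_2)(x)=\omega_1((\iota\odot\omega_2)\Delta(x))$. **Theorem.** Let $(A,\Delta)$ be an algebraic quantum group and let $\varphi$ be a non-zero left invariant functional on $A$. Then $\hat A$ is a non-degenerate associative algebra, $(A,\Delta)$ has exactly one counit $\varepsilon$, and the following holds. Let $$\tilde A=\{\theta\in A'\mid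 (\theta\odot\iota)\Delta(a)\in A\text{ and }(\iota\odot\theta)\Delta(a)\in A\text{ for all }a\in A\},$$ which contains $\hat A$. There is a linear isomorphism $F:\tilde A\to M(\hat A)$ such that, for all $\theta\in\tilde A$, $\omega\in\hat A$ and $x\in A$, $$(F(\theta)\,\omega)(x)=\theta((\iota\odot\omega)\Delta(x)),\qquad(\omega\,F(\theta))(x)=\theta((\omega\odot\iota)\Delta(x)),$$ and $F$ restricts to the canonical embedding $\hat A\subseteq M(\hat A)$. If $M(\hat A)$ is identified with $\tilde A$ through $F$, then its product is given by $$(\theta_1\theta_2)(a)=\theta_1((\iota\odot\theta_2)\Delta(a))=\theta_2((\theta_1\odot\iota)\Delta(a))\qquad(\theta_1,\theta_2\in\tilde A,\ a\in A),$$ and the counit $\varepsilon$ is the unit of $M(\hat A)$. -/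

import Mathlib

open scoped TensorProduct

noncomputable section

namespace AlgQuantumGroup

/-! ### Non-degenerate algebras and multiplier algebras -/

section Multipliers

/-- `a b = 0` for all `b` implies `a = 0`, and `b a = 0` for all `b` implies `a = 0`. -/
structure IsNondegenerate (B : Type*) [NonUnitalNonAssocRing B] : Prop where
  left : ∀ a : B, (∀ b, a * b = 0) → a = 0
  right : ∀ a : B, (∀ b, b * a = 0) → a = 0

/-- The algebra of double centralizers: pairs `(L, R)` of linear maps `B → B` with
`R(x) y = x L(y)`, with product `(L₁, R₁)(L₂, R₂) = (L₁ ∘ L₂, R₂ ∘ R₁)`. For an associative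
non-degenerate algebra `B` this is the multiplier algebra `M(B)`; the multiplier `m = (L, R)`
acts by `m x = L(x)` and `x m = R(x)`. (The construction of the unital algebra `M(B)` itself does
not use the associativity of `B`.) -/
def multiplierSubalgebra (B : Type*) [NonUnitalNonAssocRing B] [Module ℂ B]
    [IsScalarTower ℂ B B] [SMulCommClass ℂ B B] :
    Subalgebra ℂ (Module.End ℂ B × (Module.End ℂ B)ᵐᵒᵖ) where
  carrier := {m | ∀ x y : B, m.2.unop x * y = x * m.1 y}
  mul_mem' := by
    intro m n hm hn x y
    have h1 := hn (m.2.unop x) y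
    have h2 := hm x (n.1 y)
    simpa using h1.trans h2
  add_mem' := by
    intro m n hm hn x y
    have h1 := hm x y
    have h2 := hn x y
    simp [add_mul, mul_add, h1, h2]
  algebraMap_mem' := by
    intro r x y
    simp [Algebra.algebraMap_eq_smul_one, smul_mul_assoc, mul_smul_comm]

/-- The multiplier algebra `M(B)`. -/
abbrev MultiplierAlg (B : Type*) [NonUnitalNonAssocRing B] [Module ℂ B]
    [IsScalarTower ℂ B B] [SMulCommClass ℂ B B] : Type _ :=
  ↥(multiplierSubalgebra B)

section NonAssoc

variable {B : Type*} [NonUnitalNonAssocRing B] [Module ℂ B]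
  [IsScalarTower ℂ B B] [SMulCommClass ℂ B B]

/-- `x ↦ m x` for a multiplier `m`. -/
def MultiplierAlg.lmul (m : MultiplierAlg B) : B →ₗ[ℂ] B := m.1.1

/-- `x ↦ x m` for a multiplier `m`. -/
def MultiplierAlg.rmul (m : MultiplierAlg B) : B →ₗ[ℂ] B := m.1.2.unop

/-- The multiplier given by a pair `(L, R)`. -/
def MultiplierAlg.mk (L R : B →ₗ[ℂ] B) (h : ∀ x y, R x * y = x * L y) : MultiplierAlg B :=
  ⟨(L, MulOpposite.op R), h⟩

@[simp] theorem MultiplierAlg.lmul_mk (L R : B →ₗ[ℂ] B) (h : ∀ x y, R x * y = x * L y) :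
    (MultiplierAlg.mk L R h).lmul = L := rfl

@[simp] theorem MultiplierAlg.rmul_mk (L R : B →ₗ[ℂ] B) (h : ∀ x y, R x * y = x * L y) :
    (MultiplierAlg.mk L R h).rmul = R := rfl

theorem MultiplierAlg.rmul_mul_eq (m : MultiplierAlg B) (x y : B) :
    m.rmul x * y = x * m.lmul y := m.2 x y

theorem MultiplierAlg.ext' {m n : MultiplierAlg B} (h1 : ∀ x, m.lmul x = n.lmul x)
    (h2 : ∀ x, m.rmul x = n.rmul x) : m = n := by
  apply Subtype.ext
  apply Prod.ext
  · exact LinearMap.ext h1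
  · exact MulOpposite.unop_injective (LinearMap.ext h2)

@[simp] theorem MultiplierAlg.lmul_mul (m n : MultiplierAlg B) (x : B) :
    (m * n).lmul x = m.lmul (n.lmul x) := rfl

@[simp] theorem MultiplierAlg.rmul_mul (m n : MultiplierAlg B) (x : B) :
    (m * n).rmul x = n.rmul (m.rmul x) := rfl

@[simp] theorem MultiplierAlg.lmul_add (m n : MultiplierAlg B) (x : B) :
    (m + n).lmul x = m.lmul x + n.lmul x := rfl

@[simp] theorem MultiplierAlg.rmul_add (m n : MultiplierAlg B) (x : B) :
    (m + n).rmul x = m.rmul x + n.rmul x := rfl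

@[simp] theorem MultiplierAlg.lmul_smul (c : ℂ) (m : MultiplierAlg B) (x : B) :
    (c • m).lmul x = c • m.lmul x := rfl

@[simp] theorem MultiplierAlg.rmul_smul (c : ℂ) (m : MultiplierAlg B) (x : B) :
    (c • m).rmul x = c • m.rmul x := rfl

@[simp] theorem MultiplierAlg.lmul_zero (x : B) : (0 : MultiplierAlg B).lmul x = 0 := rfl

@[simp] theorem MultiplierAlg.lmul_one (x : B) : (1 : MultiplierAlg B).lmul x = x := rfl

@[simp] theorem MultiplierAlg.rmul_one (x : B) : (1 : MultiplierAlg B).rmul x = x := rfl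

variable {C : Type*} [NonUnitalNonAssocRing C] [Module ℂ C]
  [IsScalarTower ℂ C C] [SMulCommClass ℂ C C]

/-- The multiplier `m ⊗ n` of `B ⊙ C`. -/
def MultiplierAlg.tmul (m : MultiplierAlg B) (n : MultiplierAlg C) :
    MultiplierAlg (B ⊗[ℂ] C) :=
  MultiplierAlg.mk (TensorProduct.map m.lmul n.lmul) (TensorProduct.map m.rmul n.rmul) (by
    intro x y
    induction x with
    | zero => simp
    | add x₁ x₂ h₁ h₂ => simp only [map_add, add_mul, h₁, h₂]
    | tmul a b =>
      induction y with
      | zero => simp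
      | add y₁ y₂ h₁ h₂ => simp only [map_add, mul_add, h₁, h₂]
      | tmul c d => simp [MultiplierAlg.rmul_mul_eq])

@[simp] theorem MultiplierAlg.lmul_tmul (m : MultiplierAlg B) (n : MultiplierAlg C) :
    (m.tmul n).lmul = TensorProduct.map m.lmul n.lmul := rfl

@[simp] theorem MultiplierAlg.rmul_tmul (m : MultiplierAlg B) (n : MultiplierAlg C) :
    (m.tmul n).rmul = TensorProduct.map m.rmul n.rmul := rfl

/-- `(m, n) ↦ m ⊗ n` as a bilinear map `M(B) × M(C) → M(B ⊙ C)`. -/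
def MultiplierAlg.tmulBilin :
    MultiplierAlg B →ₗ[ℂ] MultiplierAlg C →ₗ[ℂ] MultiplierAlg (B ⊗[ℂ] C) :=
  LinearMap.mk₂ ℂ MultiplierAlg.tmul
    (fun m₁ m₂ n => MultiplierAlg.ext'
      (fun x => LinearMap.congr_fun (TensorProduct.map_add_left m₁.lmul m₂.lmul n.lmul) x)
      (fun x => LinearMap.congr_fun (TensorProduct.map_add_left m₁.rmul m₂.rmul n.rmul) x))
    (fun c m n => MultiplierAlg.ext'
      (fun x => LinearMap.congr_fun (TensorProduct.map_smul_left c m.lmul n.lmul) x)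
      (fun x => LinearMap.congr_fun (TensorProduct.map_smul_left c m.rmul n.rmul) x))
    (fun m n₁ n₂ => MultiplierAlg.ext'
      (fun x => LinearMap.congr_fun (TensorProduct.map_add_right m.lmul n₁.lmul n₂.lmul) x)
      (fun x => LinearMap.congr_fun (TensorProduct.map_add_right m.rmul n₁.rmul n₂.rmul) x))
    (fun c m n => MultiplierAlg.ext'
      (fun x => LinearMap.congr_fun (TensorProduct.map_smul_right c m.lmul n.lmul) x)
      (fun x => LinearMap.congr_fun (TensorProduct.map_smul_right c m.rmul n.rmul) x))

@[simp] theorem MultiplierAlg.tmulBilin_apply (m : MultiplierAlg B) (n : MultiplierAlg C) :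
    MultiplierAlg.tmulBilin m n = m.tmul n := rfl

end NonAssoc

variable {B : Type*} [NonUnitalRing B] [Module ℂ B] [IsScalarTower ℂ B B] [SMulCommClass ℂ B B]

/-- The canonical map `B → M(B)`, sending `b` to left and right multiplication by `b`. -/
def MultiplierAlg.ofElem : B →ₗ[ℂ] MultiplierAlg B where
  toFun b := MultiplierAlg.mk (LinearMap.mulLeft ℂ b) (LinearMap.mulRight ℂ b)
    (fun x y => by simp [mul_assoc])
  map_add' a b := MultiplierAlg.ext' (fun x => add_mul a b x) (fun x => mul_add x a b)
  map_smul' c b := MultiplierAlg.ext' (fun x => smul_mul_assoc c b x) (fun x => mul_smul_comm c x b)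

@[simp] theorem MultiplierAlg.lmul_ofElem (b x : B) :
    (MultiplierAlg.ofElem b).lmul x = b * x := rfl

@[simp] theorem MultiplierAlg.rmul_ofElem (b x : B) :
    (MultiplierAlg.ofElem b).rmul x = x * b := rfl

theorem IsNondegenerate.ofElem_injective (h : IsNondegenerate B) :
    Function.Injective (MultiplierAlg.ofElem : B →ₗ[ℂ] MultiplierAlg B) := by
  rw [injective_iff_map_eq_zero]
  intro a ha
  refine h.left a fun b => ?_
  have := congrArg (fun m : MultiplierAlg B => m.lmul b) ha
  simpa only [MultiplierAlg.lmul_ofElem, MultiplierAlg.lmul_zero] using this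

theorem IsNondegenerate.ofElem_rmul (h : IsNondegenerate B) (m : MultiplierAlg B) (x : B) :
    MultiplierAlg.ofElem (m.rmul x) = MultiplierAlg.ofElem x * m := by
  refine MultiplierAlg.ext' (fun y => ?_) (fun y => ?_)
  · simp [MultiplierAlg.rmul_mul_eq]
  · simp only [MultiplierAlg.rmul_ofElem, MultiplierAlg.rmul_mul]
    rw [← sub_eq_zero]
    refine h.left _ fun b => ?_
    simp [sub_mul, mul_assoc, MultiplierAlg.rmul_mul_eq]

theorem IsNondegenerate.ofElem_lmul (h : IsNondegenerate B) (m : MultiplierAlg B) (x : B) :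
    MultiplierAlg.ofElem (m.lmul x) = m * MultiplierAlg.ofElem x := by
  refine MultiplierAlg.ext' (fun y => ?_) (fun y => ?_)
  · simp only [MultiplierAlg.lmul_ofElem, MultiplierAlg.lmul_mul]
    rw [← sub_eq_zero]
    refine h.right _ fun b => ?_
    rw [mul_sub, ← mul_assoc, ← MultiplierAlg.rmul_mul_eq, ← MultiplierAlg.rmul_mul_eq]
    simp [mul_assoc]
  · simp [MultiplierAlg.rmul_mul_eq]

end Multipliers

/-! ### Slice maps on the algebraic tensor product -/

section Slices

variable {V : Type*} [AddCommGroup V] [Module ℂ V]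

/-- `ω ⊙ ι : V ⊙ V → V`. -/
def sliceFst (ω : Module.Dual ℂ V) : V ⊗[ℂ] V →ₗ[ℂ] V :=
  (TensorProduct.lid ℂ V).toLinearMap ∘ₗ LinearMap.rTensor V ω

/-- `ι ⊙ ω : V ⊙ V → V`. -/
def sliceSnd (ω : Module.Dual ℂ V) : V ⊗[ℂ] V →ₗ[ℂ] V :=
  (TensorProduct.rid ℂ V).toLinearMap ∘ₗ LinearMap.lTensor V ω

@[simp] theorem sliceFst_tmul (ω : Module.Dual ℂ V) (a b : V) :
    sliceFst ω (a ⊗ₜ b) = ω a • b := by simp [sliceFst]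

@[simp] theorem sliceSnd_tmul (ω : Module.Dual ℂ V) (a b : V) :
    sliceSnd ω (a ⊗ₜ b) = ω b • a := by simp [sliceSnd]

theorem sliceFst_add (ω ω' : Module.Dual ℂ V) (z : V ⊗[ℂ] V) :
    sliceFst (ω + ω') z = sliceFst ω z + sliceFst ω' z := by
  simp [sliceFst, LinearMap.rTensor_add]

theorem sliceFst_smul (c : ℂ) (ω : Module.Dual ℂ V) (z : V ⊗[ℂ] V) :
    sliceFst (c • ω) z = c • sliceFst ω z := by
  simp [sliceFst, LinearMap.rTensor_smul]

theorem sliceSnd_add (ω ω' : Module.Dual ℂ V) (z : V ⊗[ℂ] V) :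
    sliceSnd (ω + ω') z = sliceSnd ω z + sliceSnd ω' z := by
  simp [sliceSnd, LinearMap.lTensor_add]

theorem sliceSnd_smul (c : ℂ) (ω : Module.Dual ℂ V) (z : V ⊗[ℂ] V) :
    sliceSnd (c • ω) z = c • sliceSnd ω z := by
  simp [sliceSnd, LinearMap.lTensor_smul]

theorem apply_sliceSnd (f g : Module.Dual ℂ V) (z : V ⊗[ℂ] V) :
    f (sliceSnd g z) = g (sliceFst f z) := by
  induction z with
  | zero => simp
  | add x y hx hy => simp only [map_add, hx, hy]
  | tmul a b => simp [mul_comm]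

/-- Slices by all functionals separate the points of `V ⊙ V`. -/
theorem eq_zero_of_sliceSnd (z : V ⊗[ℂ] V) (hz : ∀ ω : Module.Dual ℂ V, sliceSnd ω z = 0) :
    z = 0 := by
  classical
  let b := Module.Basis.ofVectorSpace ℂ V
  have key : ∀ (i) (z : V ⊗[ℂ] V), TensorProduct.equivFinsuppOfBasisRight b z i
      = sliceSnd (b.coord i) z := by
    intro i z
    induction z with
    | zero => simp
    | add x y hx hy => simp [hx, hy]
    | tmul x y => simp
  apply (TensorProduct.equivFinsuppOfBasisRight b).injective
  ext i
  rw [key, hz]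
  simp

end Slices

section TensorNondegenerate

variable {A : Type*} [NonUnitalRing A] [Module ℂ A] [IsScalarTower ℂ A A] [SMulCommClass ℂ A A]

theorem sliceSnd_mul_tmul (ω : Module.Dual ℂ A) (z : A ⊗[ℂ] A) (c d : A) :
    sliceSnd ω (z * (c ⊗ₜ d)) = sliceSnd (ω ∘ₗ LinearMap.mulRight ℂ d) z * c := by
  induction z with
  | zero => simp
  | add x y hx hy => simp only [add_mul, map_add, hx, hy]
  | tmul a b => simp [smul_mul_assoc]

theorem sliceSnd_tmul_mul (ω : Module.Dual ℂ A) (z : A ⊗[ℂ] A) (c d : A) :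
    sliceSnd ω ((c ⊗ₜ d) * z) = c * sliceSnd (ω ∘ₗ LinearMap.mulLeft ℂ d) z := by
  induction z with
  | zero => simp
  | add x y hx hy => simp only [mul_add, map_add, hx, hy]
  | tmul a b => simp [mul_smul_comm]

theorem IsNondegenerate.tensor (h : IsNondegenerate A) : IsNondegenerate (A ⊗[ℂ] A) where
  left z hz := by
    refine eq_zero_of_sliceSnd z fun ω => ?_
    rw [← Module.forall_dual_apply_eq_zero_iff ℂ]
    intro f
    rw [apply_sliceSnd, h.left (sliceFst f z), map_zero]
    intro d
    rw [← Module.forall_dual_apply_eq_zero_iff ℂ]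
    intro ω
    change (ω ∘ₗ LinearMap.mulRight ℂ d) (sliceFst f z) = 0
    rw [← apply_sliceSnd, h.left (sliceSnd _ z), map_zero]
    intro c
    rw [← sliceSnd_mul_tmul, hz, map_zero]
  right z hz := by
    refine eq_zero_of_sliceSnd z fun ω => ?_
    rw [← Module.forall_dual_apply_eq_zero_iff ℂ]
    intro f
    rw [apply_sliceSnd, h.right (sliceFst f z), map_zero]
    intro d
    rw [← Module.forall_dual_apply_eq_zero_iff ℂ]
    intro ω
    change (ω ∘ₗ LinearMap.mulLeft ℂ d) (sliceFst f z) = 0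
    rw [← apply_sliceSnd, h.right (sliceSnd _ z), map_zero]
    intro c
    rw [← sliceSnd_tmul_mul, hz, map_zero]

end TensorNondegenerate

/-! ### Regular multiplier Hopf algebras -/

section Hopf

variable {A : Type*} [NonUnitalRing A] [Module ℂ A] [IsScalarTower ℂ A A] [SMulCommClass ℂ A A]

/-- `b ↦ b ⊗ 1`, from `A` to `M(A ⊙ A)`. -/
def inFst : A →ₗ[ℂ] MultiplierAlg (A ⊗[ℂ] A) :=
  MultiplierAlg.tmulBilin.flip 1 ∘ₗ MultiplierAlg.ofElem

/-- `b ↦ 1 ⊗ b`, from `A` to `M(A ⊙ A)`. -/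
def inSnd : A →ₗ[ℂ] MultiplierAlg (A ⊗[ℂ] A) :=
  MultiplierAlg.tmulBilin 1 ∘ₗ MultiplierAlg.ofElem

/-- `T₁(a ⊗ b) = Δ(a)(b ⊗ 1)`, with values in `M(A ⊙ A)`. -/
def mapT₁ (Δ : A →ₙₐ[ℂ] MultiplierAlg (A ⊗[ℂ] A)) : A ⊗[ℂ] A →ₗ[ℂ] MultiplierAlg (A ⊗[ℂ] A) :=
  TensorProduct.lift ((LinearMap.mul ℂ _).compl₁₂ (Δ : A →ₗ[ℂ] _) inFst)

/-- `T₂(a ⊗ b) = Δ(a)(1 ⊗ b)`, with values in `M(A ⊙ A)`. -/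
def mapT₂ (Δ : A →ₙₐ[ℂ] MultiplierAlg (A ⊗[ℂ] A)) : A ⊗[ℂ] A →ₗ[ℂ] MultiplierAlg (A ⊗[ℂ] A) :=
  TensorProduct.lift ((LinearMap.mul ℂ _).compl₁₂ (Δ : A →ₗ[ℂ] _) inSnd)

/-- `T₃(a ⊗ b) = (b ⊗ 1)Δ(a)`, with values in `M(A ⊙ A)`. -/
def mapT₃ (Δ : A →ₙₐ[ℂ] MultiplierAlg (A ⊗[ℂ] A)) : A ⊗[ℂ] A →ₗ[ℂ] MultiplierAlg (A ⊗[ℂ] A) :=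
  TensorProduct.lift ((LinearMap.mul ℂ _).flip.compl₁₂ (Δ : A →ₗ[ℂ] _) inFst)

/-- `T₄(a ⊗ b) = (1 ⊗ b)Δ(a)`, with values in `M(A ⊙ A)`. -/
def mapT₄ (Δ : A →ₙₐ[ℂ] MultiplierAlg (A ⊗[ℂ] A)) : A ⊗[ℂ] A →ₗ[ℂ] MultiplierAlg (A ⊗[ℂ] A) :=
  TensorProduct.lift ((LinearMap.mul ℂ _).flip.compl₁₂ (Δ : A →ₗ[ℂ] _) inSnd)

@[simp] theorem mapT₁_tmul (Δ : A →ₙₐ[ℂ] MultiplierAlg (A ⊗[ℂ] A)) (a b : A) :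
    mapT₁ Δ (a ⊗ₜ b) = Δ a * inFst b := by simp [mapT₁]

@[simp] theorem mapT₂_tmul (Δ : A →ₙₐ[ℂ] MultiplierAlg (A ⊗[ℂ] A)) (a b : A) :
    mapT₂ Δ (a ⊗ₜ b) = Δ a * inSnd b := by simp [mapT₂]

@[simp] theorem mapT₃_tmul (Δ : A →ₙₐ[ℂ] MultiplierAlg (A ⊗[ℂ] A)) (a b : A) :
    mapT₃ Δ (a ⊗ₜ b) = inFst b * Δ a := by simp [mapT₃]

@[simp] theorem mapT₄_tmul (Δ : A →ₙₐ[ℂ] MultiplierAlg (A ⊗[ℂ] A)) (a b : A) :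
    mapT₄ Δ (a ⊗ₜ b) = inSnd b * Δ a := by simp [mapT₄]

/-- `Δ ⊙ ι : A ⊙ A → M((A ⊙ A) ⊙ A)`. -/
def comulTensorId (Δ : A →ₙₐ[ℂ] MultiplierAlg (A ⊗[ℂ] A)) :
    A ⊗[ℂ] A →ₗ[ℂ] MultiplierAlg ((A ⊗[ℂ] A) ⊗[ℂ] A) :=
  TensorProduct.lift
    (MultiplierAlg.tmulBilin.compl₁₂ (Δ : A →ₗ[ℂ] _) (MultiplierAlg.ofElem (B := A)))

/-- `ι ⊙ Δ : A ⊙ A → M(A ⊙ (A ⊙ A))`. -/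
def idTensorComul (Δ : A →ₙₐ[ℂ] MultiplierAlg (A ⊗[ℂ] A)) :
    A ⊗[ℂ] A →ₗ[ℂ] MultiplierAlg (A ⊗[ℂ] (A ⊗[ℂ] A)) :=
  TensorProduct.lift
    (MultiplierAlg.tmulBilin.compl₁₂ (MultiplierAlg.ofElem (B := A)) (Δ : A →ₗ[ℂ] _))

/-- `n = π̄(m)` where `π̄ : M(B) → M(C)` is the canonical extension of a non-degenerate homomorphism
`π : B → M(C)`: the value `π̄(m)` is the unique multiplier `n` with `n π(b) = π(m b)` and
`π(b) n = π(b m)` for all `b ∈ B`. -/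
def IsExtensionValue {B C : Type*} [NonUnitalNonAssocRing B] [Module ℂ B] [IsScalarTower ℂ B B]
    [SMulCommClass ℂ B B] [NonUnitalNonAssocRing C] [Module ℂ C] [IsScalarTower ℂ C C]
    [SMulCommClass ℂ C C] (π : B →ₗ[ℂ] MultiplierAlg C) (m : MultiplierAlg B)
    (n : MultiplierAlg C) : Prop :=
  ∀ b : B, n * π b = π (m.lmul b) ∧ π b * n = π (m.rmul b)

/-- `(Δ ⊙ ι)Δ = (ι ⊙ Δ)Δ`, where `Δ ⊙ ι` and `ι ⊙ Δ` are extended to `M(A ⊙ A)` and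
`(A ⊙ A) ⊙ A` is identified with `A ⊙ (A ⊙ A)` by the associativity isomorphism. -/
def IsCoassociative (Δ : A →ₙₐ[ℂ] MultiplierAlg (A ⊗[ℂ] A)) : Prop :=
  ∀ a : A, ∃ (n : MultiplierAlg ((A ⊗[ℂ] A) ⊗[ℂ] A)) (n' : MultiplierAlg (A ⊗[ℂ] (A ⊗[ℂ] A))),
    IsExtensionValue (comulTensorId Δ) (Δ a) n ∧ IsExtensionValue (idTensorComul Δ) (Δ a) n' ∧
    ∀ x, TensorProduct.assoc ℂ A A A (n.lmul x) = n'.lmul (TensorProduct.assoc ℂ A A A x) ∧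
      TensorProduct.assoc ℂ A A A (n.rmul x) = n'.rmul (TensorProduct.assoc ℂ A A A x)

/-- `(A, Δ)` is a regular multiplier Hopf algebra: `A` is a non-degenerate algebra,
`Δ : A → M(A ⊙ A)` is a non-degenerate coassociative homomorphism, and `T₁, T₂, T₃, T₄` are
bijections from `A ⊙ A` onto `A ⊙ A ⊆ M(A ⊙ A)`. -/
structure IsRegularMultiplierHopf (Δ : A →ₙₐ[ℂ] MultiplierAlg (A ⊗[ℂ] A)) : Prop where
  nondegenerate : IsNondegenerate A
  span_lmul : Submodule.span ℂ {y | ∃ (a : A) (x : A ⊗[ℂ] A), y = (Δ a).lmul x} = ⊤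
  span_rmul : Submodule.span ℂ {y | ∃ (a : A) (x : A ⊗[ℂ] A), y = (Δ a).rmul x} = ⊤
  coassoc : IsCoassociative Δ
  bijOn_T₁ : Set.BijOn (mapT₁ Δ) Set.univ (Set.range MultiplierAlg.ofElem)
  bijOn_T₂ : Set.BijOn (mapT₂ Δ) Set.univ (Set.range MultiplierAlg.ofElem)
  bijOn_T₃ : Set.BijOn (mapT₃ Δ) Set.univ (Set.range MultiplierAlg.ofElem)
  bijOn_T₄ : Set.BijOn (mapT₄ Δ) Set.univ (Set.range MultiplierAlg.ofElem)


/-! Slicing and multiplication by `b ⊗ 1` and `1 ⊗ b`. -/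

theorem sliceFst_lmul_inSnd (ω : Module.Dual ℂ A) (b : A) (z : A ⊗[ℂ] A) :
    sliceFst ω ((inSnd b).lmul z) = b * sliceFst ω z := by
  induction z with
  | zero => simp
  | add x y hx hy => simp only [map_add, mul_add, hx, hy]
  | tmul x y => simp [inSnd, mul_smul_comm]

theorem sliceFst_rmul_inSnd (ω : Module.Dual ℂ A) (b : A) (z : A ⊗[ℂ] A) :
    sliceFst ω ((inSnd b).rmul z) = sliceFst ω z * b := by
  induction z with
  | zero => simp
  | add x y hx hy => simp only [map_add, add_mul, hx, hy]
  | tmul x y => simp [inSnd, smul_mul_assoc]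

theorem sliceSnd_lmul_inFst (ω : Module.Dual ℂ A) (b : A) (z : A ⊗[ℂ] A) :
    sliceSnd ω ((inFst b).lmul z) = b * sliceSnd ω z := by
  induction z with
  | zero => simp
  | add x y hx hy => simp only [map_add, mul_add, hx, hy]
  | tmul x y => simp [inFst, mul_smul_comm]

theorem sliceSnd_rmul_inFst (ω : Module.Dual ℂ A) (b : A) (z : A ⊗[ℂ] A) :
    sliceSnd ω ((inFst b).rmul z) = sliceSnd ω z * b := by
  induction z with
  | zero => simp
  | add x y hx hy => simp only [map_add, add_mul, hx, hy]
  | tmul x y => simp [inFst, smul_mul_assoc]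

theorem sliceFst_lmul_inFst (ω : Module.Dual ℂ A) (b : A) (z : A ⊗[ℂ] A) :
    sliceFst ω ((inFst b).lmul z) = sliceFst (ω ∘ₗ LinearMap.mulLeft ℂ b) z := by
  induction z with
  | zero => simp
  | add x y hx hy => simp only [map_add, hx, hy]
  | tmul x y => simp [inFst]

theorem sliceSnd_lmul_inSnd (ω : Module.Dual ℂ A) (b : A) (z : A ⊗[ℂ] A) :
    sliceSnd ω ((inSnd b).lmul z) = sliceSnd (ω ∘ₗ LinearMap.mulLeft ℂ b) z := by
  induction z with
  | zero => simp
  | add x y hx hy => simp only [map_add, hx, hy]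
  | tmul x y => simp [inSnd]

theorem inFst_mul_inSnd (a b : A) : inFst a * inSnd b = inSnd b * inFst a := by
  refine MultiplierAlg.ext' (fun z => ?_) (fun z => ?_) <;>
  · induction z with
    | zero => simp
    | add x y hx hy => simp only [map_add, hx, hy]
    | tmul x y => simp [inFst, inSnd]

namespace IsRegularMultiplierHopf

variable {Δ : A →ₙₐ[ℂ] MultiplierAlg (A ⊗[ℂ] A)}

/-- The inclusion `A ⊙ A → M(A ⊙ A)` as an isomorphism onto its range. -/
def elemEquiv (h : IsRegularMultiplierHopf Δ) : (A ⊗[ℂ] A) ≃ₗ[ℂ]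
    LinearMap.range (MultiplierAlg.ofElem : (A ⊗[ℂ] A) →ₗ[ℂ] MultiplierAlg (A ⊗[ℂ] A)) :=
  LinearEquiv.ofInjective MultiplierAlg.ofElem h.nondegenerate.tensor.ofElem_injective

/-- `T₁` as a map `A ⊙ A → A ⊙ A`. -/
def T₁ (h : IsRegularMultiplierHopf Δ) : A ⊗[ℂ] A →ₗ[ℂ] A ⊗[ℂ] A :=
  h.elemEquiv.symm.toLinearMap ∘ₗ
    (mapT₁ Δ).codRestrict _ (fun z => h.bijOn_T₁.mapsTo (Set.mem_univ z))

/-- `T₂` as a map `A ⊙ A → A ⊙ A`. -/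
def T₂ (h : IsRegularMultiplierHopf Δ) : A ⊗[ℂ] A →ₗ[ℂ] A ⊗[ℂ] A :=
  h.elemEquiv.symm.toLinearMap ∘ₗ
    (mapT₂ Δ).codRestrict _ (fun z => h.bijOn_T₂.mapsTo (Set.mem_univ z))

/-- `T₃` as a map `A ⊙ A → A ⊙ A`. -/
def T₃ (h : IsRegularMultiplierHopf Δ) : A ⊗[ℂ] A →ₗ[ℂ] A ⊗[ℂ] A :=
  h.elemEquiv.symm.toLinearMap ∘ₗ
    (mapT₃ Δ).codRestrict _ (fun z => h.bijOn_T₃.mapsTo (Set.mem_univ z))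

/-- `T₄` as a map `A ⊙ A → A ⊙ A`. -/
def T₄ (h : IsRegularMultiplierHopf Δ) : A ⊗[ℂ] A →ₗ[ℂ] A ⊗[ℂ] A :=
  h.elemEquiv.symm.toLinearMap ∘ₗ
    (mapT₄ Δ).codRestrict _ (fun z => h.bijOn_T₄.mapsTo (Set.mem_univ z))

theorem ofElem_elemEquiv_symm (h : IsRegularMultiplierHopf Δ)
    (m : LinearMap.range
      (MultiplierAlg.ofElem : (A ⊗[ℂ] A) →ₗ[ℂ] MultiplierAlg (A ⊗[ℂ] A))) :
    MultiplierAlg.ofElem (h.elemEquiv.symm m) = m.1 :=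
  congrArg Subtype.val (h.elemEquiv.apply_symm_apply m)

theorem ofElem_T₁ (h : IsRegularMultiplierHopf Δ) (z : A ⊗[ℂ] A) :
    MultiplierAlg.ofElem (h.T₁ z) = mapT₁ Δ z := h.ofElem_elemEquiv_symm _

theorem ofElem_T₂ (h : IsRegularMultiplierHopf Δ) (z : A ⊗[ℂ] A) :
    MultiplierAlg.ofElem (h.T₂ z) = mapT₂ Δ z := h.ofElem_elemEquiv_symm _

theorem ofElem_T₃ (h : IsRegularMultiplierHopf Δ) (z : A ⊗[ℂ] A) :
    MultiplierAlg.ofElem (h.T₃ z) = mapT₃ Δ z := h.ofElem_elemEquiv_symm _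

theorem ofElem_T₄ (h : IsRegularMultiplierHopf Δ) (z : A ⊗[ℂ] A) :
    MultiplierAlg.ofElem (h.T₄ z) = mapT₄ Δ z := h.ofElem_elemEquiv_symm _

/-- `((1 ⊗ x) Δ(a)) (1 ⊗ y) = (1 ⊗ x) (Δ(a) (1 ⊗ y))` in `A ⊙ A`. -/
theorem rmul_T₄ (h : IsRegularMultiplierHopf Δ) (a x y : A) :
    (inSnd y).rmul (h.T₄ (a ⊗ₜ x)) = (inSnd x).lmul (h.T₂ (a ⊗ₜ y)) := by
  apply h.nondegenerate.tensor.ofElem_injective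
  rw [h.nondegenerate.tensor.ofElem_rmul, h.nondegenerate.tensor.ofElem_lmul, ofElem_T₄,
    ofElem_T₂, mapT₄_tmul, mapT₂_tmul, mul_assoc]

/-- `((x ⊗ 1) Δ(a)) (y ⊗ 1) = (x ⊗ 1) (Δ(a) (y ⊗ 1))` in `A ⊙ A`. -/
theorem rmul_T₃ (h : IsRegularMultiplierHopf Δ) (a x y : A) :
    (inFst y).rmul (h.T₃ (a ⊗ₜ x)) = (inFst x).lmul (h.T₁ (a ⊗ₜ y)) := by
  apply h.nondegenerate.tensor.ofElem_injective
  rw [h.nondegenerate.tensor.ofElem_rmul, h.nondegenerate.tensor.ofElem_lmul, ofElem_T₃,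
    ofElem_T₁, mapT₃_tmul, mapT₁_tmul, mul_assoc]

/-- `((1 ⊗ x) Δ(a)) (y ⊗ 1) = (1 ⊗ x) (Δ(a) (y ⊗ 1))` in `A ⊙ A`. -/
theorem rmul_T₄' (h : IsRegularMultiplierHopf Δ) (a x y : A) :
    (inFst y).rmul (h.T₄ (a ⊗ₜ x)) = (inSnd x).lmul (h.T₁ (a ⊗ₜ y)) := by
  apply h.nondegenerate.tensor.ofElem_injective
  rw [h.nondegenerate.tensor.ofElem_rmul, h.nondegenerate.tensor.ofElem_lmul, ofElem_T₄,
    ofElem_T₁, mapT₄_tmul, mapT₁_tmul, mul_assoc]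

/-- `((x ⊗ 1) Δ(a)) (1 ⊗ y) = (x ⊗ 1) (Δ(a) (1 ⊗ y))` in `A ⊙ A`. -/
theorem rmul_T₃' (h : IsRegularMultiplierHopf Δ) (a x y : A) :
    (inSnd y).rmul (h.T₃ (a ⊗ₜ x)) = (inFst x).lmul (h.T₂ (a ⊗ₜ y)) := by
  apply h.nondegenerate.tensor.ofElem_injective
  rw [h.nondegenerate.tensor.ofElem_rmul, h.nondegenerate.tensor.ofElem_lmul, ofElem_T₃,
    ofElem_T₂, mapT₃_tmul, mapT₂_tmul, mul_assoc]

/-- `(1 ⊗ y) ((x ⊗ 1) Δ(a)) = (x ⊗ 1) ((1 ⊗ y) Δ(a))` in `A ⊙ A`. -/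
theorem lmul_T₃ (h : IsRegularMultiplierHopf Δ) (a x y : A) :
    (inSnd y).lmul (h.T₃ (a ⊗ₜ x)) = (inFst x).lmul (h.T₄ (a ⊗ₜ y)) := by
  apply h.nondegenerate.tensor.ofElem_injective
  rw [h.nondegenerate.tensor.ofElem_lmul, h.nondegenerate.tensor.ofElem_lmul, ofElem_T₃,
    ofElem_T₄, mapT₃_tmul, mapT₄_tmul, ← mul_assoc, ← mul_assoc, inFst_mul_inSnd]

/-- The multiplier `(ω ⊙ ι)Δ(a) ∈ M(A)`, given by
`[(ω ⊙ ι)Δ(a)] b = (ω ⊙ ι)(Δ(a)(1 ⊗ b))` and `b [(ω ⊙ ι)Δ(a)] = (ω ⊙ ι)((1 ⊗ b)Δ(a))`. -/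
def comulSliceFst (h : IsRegularMultiplierHopf Δ) (ω : Module.Dual ℂ A) (a : A) :
    MultiplierAlg A :=
  MultiplierAlg.mk (sliceFst ω ∘ₗ h.T₂ ∘ₗ TensorProduct.mk ℂ A A a)
    (sliceFst ω ∘ₗ h.T₄ ∘ₗ TensorProduct.mk ℂ A A a) (fun x y => by
      simp only [LinearMap.comp_apply, TensorProduct.mk_apply]
      rw [← sliceFst_rmul_inSnd, ← sliceFst_lmul_inSnd, rmul_T₄])

/-- The multiplier `(ι ⊙ ω)Δ(a) ∈ M(A)`, given by
`[(ι ⊙ ω)Δ(a)] b = (ι ⊙ ω)(Δ(a)(b ⊗ 1))` and `b [(ι ⊙ ω)Δ(a)] = (ι ⊙ ω)((b ⊗ 1)Δ(a))`. -/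
def comulSliceSnd (h : IsRegularMultiplierHopf Δ) (ω : Module.Dual ℂ A) (a : A) :
    MultiplierAlg A :=
  MultiplierAlg.mk (sliceSnd ω ∘ₗ h.T₁ ∘ₗ TensorProduct.mk ℂ A A a)
    (sliceSnd ω ∘ₗ h.T₃ ∘ₗ TensorProduct.mk ℂ A A a) (fun x y => by
      simp only [LinearMap.comp_apply, TensorProduct.mk_apply]
      rw [← sliceSnd_rmul_inFst, ← sliceSnd_lmul_inFst, rmul_T₃])

@[simp] theorem lmul_comulSliceFst (h : IsRegularMultiplierHopf Δ) (ω : Module.Dual ℂ A)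
    (a b : A) : (h.comulSliceFst ω a).lmul b = sliceFst ω (h.T₂ (a ⊗ₜ b)) := rfl

@[simp] theorem rmul_comulSliceFst (h : IsRegularMultiplierHopf Δ) (ω : Module.Dual ℂ A)
    (a b : A) : (h.comulSliceFst ω a).rmul b = sliceFst ω (h.T₄ (a ⊗ₜ b)) := rfl

@[simp] theorem lmul_comulSliceSnd (h : IsRegularMultiplierHopf Δ) (ω : Module.Dual ℂ A)
    (a b : A) : (h.comulSliceSnd ω a).lmul b = sliceSnd ω (h.T₁ (a ⊗ₜ b)) := rfl

@[simp] theorem rmul_comulSliceSnd (h : IsRegularMultiplierHopf Δ) (ω : Module.Dual ℂ A)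
    (a b : A) : (h.comulSliceSnd ω a).rmul b = sliceSnd ω (h.T₃ (a ⊗ₜ b)) := rfl

/-- `(ω, a) ↦ (ω ⊙ ι)Δ(a)` as a bilinear map. -/
def comulSliceFstBilin (h : IsRegularMultiplierHopf Δ) :
    Module.Dual ℂ A →ₗ[ℂ] A →ₗ[ℂ] MultiplierAlg A :=
  LinearMap.mk₂ ℂ h.comulSliceFst
    (fun _ _ _ => MultiplierAlg.ext' (fun _ => sliceFst_add _ _ _) (fun _ => sliceFst_add _ _ _))
    (fun _ _ _ => MultiplierAlg.ext' (fun _ => sliceFst_smul _ _ _)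
      (fun _ => sliceFst_smul _ _ _))
    (fun _ _ _ => MultiplierAlg.ext' (fun _ => by simp [TensorProduct.add_tmul])
      (fun _ => by simp [TensorProduct.add_tmul]))
    (fun _ _ _ => MultiplierAlg.ext' (fun _ => by simp [← TensorProduct.smul_tmul'])
      (fun _ => by simp [← TensorProduct.smul_tmul']))

/-- `(ω, a) ↦ (ι ⊙ ω)Δ(a)` as a bilinear map. -/
def comulSliceSndBilin (h : IsRegularMultiplierHopf Δ) :
    Module.Dual ℂ A →ₗ[ℂ] A →ₗ[ℂ] MultiplierAlg A :=
  LinearMap.mk₂ ℂ h.comulSliceSnd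
    (fun _ _ _ => MultiplierAlg.ext' (fun _ => sliceSnd_add _ _ _) (fun _ => sliceSnd_add _ _ _))
    (fun _ _ _ => MultiplierAlg.ext' (fun _ => sliceSnd_smul _ _ _)
      (fun _ => sliceSnd_smul _ _ _))
    (fun _ _ _ => MultiplierAlg.ext' (fun _ => by simp [TensorProduct.add_tmul])
      (fun _ => by simp [TensorProduct.add_tmul]))
    (fun _ _ _ => MultiplierAlg.ext' (fun _ => by simp [← TensorProduct.smul_tmul'])
      (fun _ => by simp [← TensorProduct.smul_tmul']))

/-- The space of all `θ ∈ A'` such that `(θ ⊙ ι)Δ(a)` and `(ι ⊙ θ)Δ(a)` belong to `A`, for every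
`a ∈ A`. -/
def sliceSpace (h : IsRegularMultiplierHopf Δ) : Submodule ℂ (Module.Dual ℂ A) where
  carrier := {θ | ∀ a : A, h.comulSliceFst θ a ∈ LinearMap.range MultiplierAlg.ofElem ∧
    h.comulSliceSnd θ a ∈ LinearMap.range MultiplierAlg.ofElem}
  add_mem' {θ θ'} hθ hθ' a := by
    have e1 : h.comulSliceFst (θ + θ') a = h.comulSliceFst θ a + h.comulSliceFst θ' a :=
      h.comulSliceFstBilin.map_add₂ θ θ' a
    have e2 : h.comulSliceSnd (θ + θ') a = h.comulSliceSnd θ a + h.comulSliceSnd θ' a :=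
      h.comulSliceSndBilin.map_add₂ θ θ' a
    rw [e1, e2]
    exact ⟨add_mem (hθ a).1 (hθ' a).1, add_mem (hθ a).2 (hθ' a).2⟩
  zero_mem' a := by
    have e1 : h.comulSliceFst 0 a = 0 := h.comulSliceFstBilin.map_zero₂ a
    have e2 : h.comulSliceSnd 0 a = 0 := h.comulSliceSndBilin.map_zero₂ a
    rw [e1, e2]
    exact ⟨zero_mem _, zero_mem _⟩
  smul_mem' c θ hθ a := by
    have e1 : h.comulSliceFst (c • θ) a = c • h.comulSliceFst θ a :=
      h.comulSliceFstBilin.map_smul₂ c θ a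
    have e2 : h.comulSliceSnd (c • θ) a = c • h.comulSliceSnd θ a :=
      h.comulSliceSndBilin.map_smul₂ c θ a
    rw [e1, e2]
    exact ⟨Submodule.smul_mem _ _ (hθ a).1, Submodule.smul_mem _ _ (hθ a).2⟩

/-- The inclusion `A → M(A)` as an isomorphism onto its range. -/
def ofElemEquiv (h : IsRegularMultiplierHopf Δ) : A ≃ₗ[ℂ]
    LinearMap.range (MultiplierAlg.ofElem : A →ₗ[ℂ] MultiplierAlg A) :=
  LinearEquiv.ofInjective MultiplierAlg.ofElem h.nondegenerate.ofElem_injective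

/-- `(θ ⊙ ι)Δ(a)` as an element of `A`, for `θ` in the slice space. -/
def elemSliceFst (h : IsRegularMultiplierHopf Δ) (θ : h.sliceSpace) (a : A) : A :=
  h.ofElemEquiv.symm ⟨h.comulSliceFst θ a, (θ.2 a).1⟩

/-- `(ι ⊙ θ)Δ(a)` as an element of `A`, for `θ` in the slice space. -/
def elemSliceSnd (h : IsRegularMultiplierHopf Δ) (θ : h.sliceSpace) (a : A) : A :=
  h.ofElemEquiv.symm ⟨h.comulSliceSnd θ a, (θ.2 a).2⟩

theorem ofElem_elemSliceFst (h : IsRegularMultiplierHopf Δ) (θ : h.sliceSpace) (a : A) :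
    MultiplierAlg.ofElem (h.elemSliceFst θ a) = h.comulSliceFst θ a :=
  congrArg Subtype.val (h.ofElemEquiv.apply_symm_apply ⟨h.comulSliceFst θ a, (θ.2 a).1⟩)

theorem ofElem_elemSliceSnd (h : IsRegularMultiplierHopf Δ) (θ : h.sliceSpace) (a : A) :
    MultiplierAlg.ofElem (h.elemSliceSnd θ a) = h.comulSliceSnd θ a :=
  congrArg Subtype.val (h.ofElemEquiv.apply_symm_apply ⟨h.comulSliceSnd θ a, (θ.2 a).2⟩)

/-- `a ↦ (ι ⊙ θ)Δ(a)`, bilinearly in `θ` and `a`. -/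
def elemSliceSndBilin (h : IsRegularMultiplierHopf Δ) : h.sliceSpace →ₗ[ℂ] A →ₗ[ℂ] A :=
  LinearMap.mk₂ ℂ h.elemSliceSnd
    (fun θ θ' a => h.nondegenerate.ofElem_injective (by
      rw [map_add, ofElem_elemSliceSnd, ofElem_elemSliceSnd, ofElem_elemSliceSnd]
      exact h.comulSliceSndBilin.map_add₂ _ _ a))
    (fun c θ a => h.nondegenerate.ofElem_injective (by
      rw [map_smul, ofElem_elemSliceSnd, ofElem_elemSliceSnd]
      exact h.comulSliceSndBilin.map_smul₂ c _ a))
    (fun θ a b => h.nondegenerate.ofElem_injective (by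
      rw [map_add, ofElem_elemSliceSnd, ofElem_elemSliceSnd, ofElem_elemSliceSnd]
      exact (h.comulSliceSndBilin θ.1).map_add a b))
    (fun c θ a => h.nondegenerate.ofElem_injective (by
      rw [map_smul, ofElem_elemSliceSnd, ofElem_elemSliceSnd]
      exact (h.comulSliceSndBilin _).map_smul c a))

/-- A counit: a non-zero homomorphism `ε : A → ℂ` with `(ε ⊙ ι)Δ = (ι ⊙ ε)Δ = ι`. -/
structure IsCounit (h : IsRegularMultiplierHopf Δ) (ε : A →ₙₐ[ℂ] ℂ) : Prop where
  ne_zero : ε ≠ 0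
  sliceFst_eq : ∀ a, h.comulSliceFst (ε : A →ₗ[ℂ] ℂ) a = MultiplierAlg.ofElem a
  sliceSnd_eq : ∀ a, h.comulSliceSnd (ε : A →ₗ[ℂ] ℂ) a = MultiplierAlg.ofElem a

/-- `ω` is left invariant: `(ι ⊙ ω)Δ(a) = ω(a) 1` for all `a`. -/
def IsLeftInvariant (h : IsRegularMultiplierHopf Δ) (ω : Module.Dual ℂ A) : Prop :=
  ∀ a, h.comulSliceSnd ω a = ω a • 1

/-! ### The dual algebra -/

/-- The functional `φ a`, `(φ a)(x) = φ(a x)`. -/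
def _root_.AlgQuantumGroup.functionalMul (φ : Module.Dual ℂ A) (a : A) : Module.Dual ℂ A :=
  φ ∘ₗ LinearMap.mulLeft ℂ a

theorem functionalMul_mem_sliceSpace (h : IsRegularMultiplierHopf Δ) (φ : Module.Dual ℂ A)
    (b : A) : functionalMul φ b ∈ h.sliceSpace := by
  intro x
  constructor
  · refine ⟨sliceFst φ (h.T₃ (x ⊗ₜ b)), MultiplierAlg.ext' (fun y => ?_) (fun y => ?_)⟩
    · rw [MultiplierAlg.lmul_ofElem, lmul_comulSliceFst, ← sliceFst_rmul_inSnd, rmul_T₃',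
        sliceFst_lmul_inFst]
      rfl
    · rw [MultiplierAlg.rmul_ofElem, rmul_comulSliceFst, ← sliceFst_lmul_inSnd, lmul_T₃,
        sliceFst_lmul_inFst]
      rfl
  · refine ⟨sliceSnd φ (h.T₄ (x ⊗ₜ b)), MultiplierAlg.ext' (fun y => ?_) (fun y => ?_)⟩
    · rw [MultiplierAlg.lmul_ofElem, lmul_comulSliceSnd, ← sliceSnd_rmul_inFst, rmul_T₄',
        sliceSnd_lmul_inSnd]
      rfl
    · rw [MultiplierAlg.rmul_ofElem, rmul_comulSliceSnd, ← sliceSnd_lmul_inFst, ← lmul_T₃,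
        sliceSnd_lmul_inSnd]
      rfl

/-- The subspace `Â = {φ a | a ∈ A}` of `A'`. -/
def _root_.AlgQuantumGroup.dualSubspace (φ : Module.Dual ℂ A) : Submodule ℂ (Module.Dual ℂ A) :=
  LinearMap.range (LinearMap.llcomp ℂ A A ℂ φ ∘ₗ LinearMap.mul ℂ A)

theorem mem_dualSubspace (φ ω : Module.Dual ℂ A) :
    ω ∈ dualSubspace φ ↔ ∃ a, functionalMul φ a = ω := Iff.rfl

theorem dualSubspace_le (h : IsRegularMultiplierHopf Δ) (φ : Module.Dual ℂ A) :
    dualSubspace φ ≤ h.sliceSpace := by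
  rintro _ ⟨b, rfl⟩
  exact h.functionalMul_mem_sliceSpace φ b

/-- The functional `a ↦ θ₁((ι ⊙ θ₂)Δ(a))`. -/
def convolution (h : IsRegularMultiplierHopf Δ) (θ₁ : Module.Dual ℂ A) (θ₂ : h.sliceSpace) :
    Module.Dual ℂ A :=
  θ₁ ∘ₗ h.elemSliceSndBilin θ₂

@[simp] theorem convolution_apply (h : IsRegularMultiplierHopf Δ) (θ₁ : Module.Dual ℂ A)
    (θ₂ : h.sliceSpace) (a : A) : h.convolution θ₁ θ₂ a = θ₁ (h.elemSliceSnd θ₂ a) := rfl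

theorem rmul_comul_T₃ (h : IsRegularMultiplierHopf Δ) (x p q : A) :
    (Δ x).rmul (h.T₃ (p ⊗ₜ q)) = h.T₃ ((p * x) ⊗ₜ q) := by
  apply h.nondegenerate.tensor.ofElem_injective
  rw [h.nondegenerate.tensor.ofElem_rmul, ofElem_T₃, ofElem_T₃, mapT₃_tmul, mapT₃_tmul,
    map_mul, mul_assoc]

theorem haar_rmul_comul_T₃ (h : IsRegularMultiplierHopf Δ) {φ : Module.Dual ℂ A}
    (hφ : h.IsLeftInvariant φ) (x : A) (w : A ⊗[ℂ] A) :
    φ (sliceSnd φ ((Δ x).rmul (h.T₃ w))) = φ (sliceSnd φ w * x) := by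
  induction w with
  | zero => simp
  | add u v hu hv => simp only [map_add, add_mul, hu, hv]
  | tmul p q =>
    rw [rmul_comul_T₃, ← rmul_comulSliceSnd, hφ]
    simp [mul_comm, smul_mul_assoc]

theorem elemSliceSnd_mul (h : IsRegularMultiplierHopf Δ) (θ : h.sliceSpace) (a x : A) :
    a * h.elemSliceSnd θ x = sliceSnd θ.1 (h.T₃ (x ⊗ₜ a)) := by
  rw [← rmul_comulSliceSnd, ← ofElem_elemSliceSnd, MultiplierAlg.rmul_ofElem]

theorem convolution_mem_dualSubspace (h : IsRegularMultiplierHopf Δ) {φ : Module.Dual ℂ A}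
    (hφ : h.IsLeftInvariant φ) {ω₁ ω₂ : Module.Dual ℂ A} (h₁ : ω₁ ∈ dualSubspace φ)
    (h₂ : ω₂ ∈ dualSubspace φ) :
    h.convolution ω₁ ⟨ω₂, h.dualSubspace_le φ h₂⟩ ∈ dualSubspace φ := by
  obtain ⟨a, rfl⟩ := h₁
  obtain ⟨b, rfl⟩ := h₂
  obtain ⟨w, -, hw⟩ := h.bijOn_T₃.surjOn ⟨a ⊗ₜ[ℂ] b, rfl⟩
  rw [← h.ofElem_T₃] at hw
  have hw' := h.nondegenerate.tensor.ofElem_injective hw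
  refine ⟨sliceSnd φ w, LinearMap.ext fun x => ?_⟩
  change φ (sliceSnd φ w * x) = φ (a * h.elemSliceSnd _ x)
  rw [elemSliceSnd_mul, ← haar_rmul_comul_T₃ h hφ, hw']
  congr 1
  change _ = sliceSnd (φ ∘ₗ LinearMap.mulLeft ℂ b) (h.T₃ (x ⊗ₜ a))
  rw [← sliceSnd_lmul_inSnd]
  congr 1
  apply h.nondegenerate.tensor.ofElem_injective
  rw [h.nondegenerate.tensor.ofElem_rmul, h.nondegenerate.tensor.ofElem_lmul, ofElem_T₃,
    mapT₃_tmul, ← mul_assoc, ← inFst_mul_inSnd]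
  congr 1
  refine MultiplierAlg.ext' (fun z => ?_) (fun z => ?_) <;>
  · induction z with
    | zero => simp
    | add x y hx hy => simp only [map_add, hx, hy]
    | tmul x y => simp [inFst, inSnd]

/-- The dual algebra `Â = {φ a | a ∈ A} ⊆ A'` of an algebraic quantum group with left Haar
functional `φ`. -/
def DualAlg (h : IsRegularMultiplierHopf Δ) {φ : Module.Dual ℂ A} (_hφ : h.IsLeftInvariant φ) :
    Type _ := ↥(dualSubspace φ)

namespace DualAlg

variable {h : IsRegularMultiplierHopf Δ} {φ : Module.Dual ℂ A} {hφ : h.IsLeftInvariant φ}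

instance instAddCommGroup : AddCommGroup (DualAlg h hφ) :=
  inferInstanceAs (AddCommGroup ↥(dualSubspace φ))

instance instModule : Module ℂ (DualAlg h hφ) :=
  inferInstanceAs (Module ℂ ↥(dualSubspace φ))

/-- An element of `Â` as a functional on `A`. -/
def toFunctional : DualAlg h hφ →ₗ[ℂ] Module.Dual ℂ A := (dualSubspace φ).subtype

theorem toFunctional_injective :
    Function.Injective (toFunctional : DualAlg h hφ →ₗ[ℂ] Module.Dual ℂ A) :=
  Subtype.val_injective

/-- The inclusion of `Â` in the space of functionals whose slices lie in `A`. -/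
def toSliceSpace : DualAlg h hφ →ₗ[ℂ] h.sliceSpace :=
  Submodule.inclusion (h.dualSubspace_le φ)

/-- The product of `Â`: `(ω₁ω₂)(a) = ω₁((ι ⊙ ω₂)Δ(a))`. -/
instance instMul : Mul (DualAlg h hφ) where
  mul ω₁ ω₂ := ⟨h.convolution ω₁.toFunctional ω₂.toSliceSpace,
    h.convolution_mem_dualSubspace hφ ω₁.2 ω₂.2⟩

theorem toFunctional_mul (ω₁ ω₂ : DualAlg h hφ) :
    (ω₁ * ω₂).toFunctional = h.convolution ω₁.toFunctional ω₂.toSliceSpace := rfl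

theorem mul_apply (ω₁ ω₂ : DualAlg h hφ) (a : A) :
    (ω₁ * ω₂).toFunctional a = ω₁.toFunctional (h.elemSliceSnd ω₂.toSliceSpace a) := rfl

theorem elemSliceSnd_add (θ θ' : h.sliceSpace) (a : A) :
    h.elemSliceSnd (θ + θ') a = h.elemSliceSnd θ a + h.elemSliceSnd θ' a :=
  h.elemSliceSndBilin.map_add₂ θ θ' a

theorem elemSliceSnd_smul (c : ℂ) (θ : h.sliceSpace) (a : A) :
    h.elemSliceSnd (c • θ) a = c • h.elemSliceSnd θ a :=
  h.elemSliceSndBilin.map_smul₂ c θ a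

instance instNonUnitalNonAssocRing : NonUnitalNonAssocRing (DualAlg h hφ) where
  __ := instAddCommGroup
  __ := instMul
  left_distrib x y z := toFunctional_injective (LinearMap.ext fun a => by
    simp [mul_apply, elemSliceSnd_add])
  right_distrib x y z := toFunctional_injective (LinearMap.ext fun a => by
    simp [mul_apply])
  zero_mul x := toFunctional_injective (LinearMap.ext fun a => by simp [mul_apply])
  mul_zero x := toFunctional_injective (LinearMap.ext fun a => by
    have : h.elemSliceSnd 0 a = 0 := h.elemSliceSndBilin.map_zero₂ a
    simp [mul_apply, this])

instance instIsScalarTower : IsScalarTower ℂ (DualAlg h hφ) (DualAlg h hφ) where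
  smul_assoc c x y := toFunctional_injective (LinearMap.ext fun a => by
    simp [mul_apply])

instance instSMulCommClass : SMulCommClass ℂ (DualAlg h hφ) (DualAlg h hφ) where
  smul_comm c x y := toFunctional_injective (LinearMap.ext fun a => by
    simp [mul_apply, elemSliceSnd_smul])

end DualAlg

end IsRegularMultiplierHopf

end Hopf

end AlgQuantumGroup

end

open AlgQuantumGroup

/-!
# The multiplier algebra of the dual of an algebraic quantum group

Write `L_ω(x) = (ι ⊙ ω)Δ(x)` and `R_ω(x) = (ω ⊙ ι)Δ(x)`. For `ω = φ(a ·)` in `Â` these operators are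
slices of `T₄` and `T₃`, so their values span `A` because `T₃` and `T₄` are surjective. This makes
`Â` non-degenerate and shows that a functional `θ` on `A` is determined by the products `θ ω`, which
are `θ ∘ L_ω`, or by the products `ω θ = θ ∘ R_ω`. Coassociativity, written as an identity in
`A ⊙ A ⊙ A` (`coassoc_T₃_T₂`), makes `R_ω` and `L_ω'` commute (`sliceT₃_sliceT₄`); together with the
exchange rules `ω(L_θ(x)) = θ(R_ω(x))` and `ω(R_θ(x)) = θ(L_ω(x))` this yields the associativity of
`Â`, the multiplier condition for `(θ ∘ L_·, θ ∘ R_·)` and the product formulas.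

The remaining point is that `θ ω` and `ω θ` lie in `Â` for `θ` in the slice space, and conversely.

* The counit `ε` is read off from `m T₂⁻¹(a ⊗ b) = ε(a) b` (`exists_counit_functional`).
* By strong left invariance, `(ι ⊙ φ)(Δ(a)(1 ⊗ x)) ↦ (ι ⊙ φ)((1 ⊗ a)Δ(x))` is a well defined linear
  automorphism `S` of `A` (`IsLeftInvariant.exists_antipode`), the antipode. It reverses products
  (`IsAntipode.map_mul`) and the comultiplication (`IsAntipode.T₃_map`). Hence `ψ = φ ∘ S⁻¹` is right
  invariant, and evaluating `(ψ ⊙ φ)((a ⊗ b)Δ(x))` in two ways gives `φ(A ·) = ψ(A ·)`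
  (`IsLeftInvariant.dualSubspace_eq`).
* Then `θ φ(a ·) = φ(S⁻¹(L_θ(S(a))) ·)` and `ψ(b ·) θ = ψ(S(R_θ(S⁻¹(b))) ·)`, so that both products
  lie in `Â` (`IsAntipode.comp_sliceT₄_mem`, `IsAntipode.comp_sliceT₃_mem`).
* Conversely, a multiplier `(l, r)` of `Â` comes from the functional `θ` with
  `θ(L_ω(x)) = l(ω)(x)`, which is well defined since `φ` is faithful
  (`IsAntipode.eq_zero_of_haar_mul`). It lies in the slice space because `L_θ(L_ω(x)) = L_{l(ω)}(x)`
  and `R_θ(R_ω(x)) = R_{r(ω)}(x)` belong to `A`.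
-/

noncomputable section

namespace AlgQuantumGroup

/-! ### Separation of points in tensor products -/

section Separation

variable {V W : Type*} [AddCommGroup V] [Module ℂ V] [AddCommGroup W] [Module ℂ W]

/-- A jointly injective family of linear maps stays jointly injective after tensoring with a vector
space. -/
theorem eq_zero_of_forall_lTensor {ι : Type*} (g : ι → W →ₗ[ℂ] W)
    (hg : ∀ w, (∀ i, g i w = 0) → w = 0) (z : V ⊗[ℂ] W)
    (hz : ∀ i, LinearMap.lTensor V (g i) z = 0) : z = 0 := by
  classical
  let b := Module.Basis.ofVectorSpace ℂ V
  have key : ∀ (i) (j) (z : V ⊗[ℂ] W),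
      TensorProduct.equivFinsuppOfBasisLeft b (LinearMap.lTensor V (g i) z) j
        = g i (TensorProduct.equivFinsuppOfBasisLeft b z j) := by
    intro i j z
    induction z with
    | zero => simp
    | add x y hx hy => simp [hx, hy]
    | tmul x y => simp
  apply (TensorProduct.equivFinsuppOfBasisLeft b).injective
  ext j
  rw [map_zero, Finsupp.zero_apply]
  refine hg _ fun i => ?_
  rw [← key, hz, map_zero, Finsupp.zero_apply]

theorem eq_zero_of_forall_rTensor {ι : Type*} (g : ι → W →ₗ[ℂ] W)
    (hg : ∀ w, (∀ i, g i w = 0) → w = 0) (z : W ⊗[ℂ] V)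
    (hz : ∀ i, LinearMap.rTensor V (g i) z = 0) : z = 0 := by
  apply (TensorProduct.comm ℂ W V).injective
  rw [map_zero]
  refine eq_zero_of_forall_lTensor g hg _ fun i => ?_
  have : LinearMap.lTensor V (g i) (TensorProduct.comm ℂ W V z)
      = TensorProduct.comm ℂ W V (LinearMap.rTensor V (g i) z) := by
    clear hz
    induction z with
    | zero => simp
    | add x y hx hy => simp [hx, hy]
    | tmul x y => simp
  rw [this, hz, map_zero]

variable {A : Type*} [NonUnitalRing A] [Module ℂ A]

theorem IsNondegenerate.eq_of_lTensor_mulRight [IsScalarTower ℂ A A] (h : IsNondegenerate A) {z z' : V ⊗[ℂ] A}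
    (hz : ∀ y, LinearMap.lTensor V (LinearMap.mulRight ℂ y) z
      = LinearMap.lTensor V (LinearMap.mulRight ℂ y) z') : z = z' := by
  rw [← sub_eq_zero]
  refine eq_zero_of_forall_lTensor (LinearMap.mulRight ℂ) (fun w hw => h.left w hw) _ fun y => ?_
  rw [map_sub, hz, sub_self]

theorem IsNondegenerate.eq_of_rTensor_mulLeft [SMulCommClass ℂ A A] (h : IsNondegenerate A) {z z' : A ⊗[ℂ] V}
    (hz : ∀ y, LinearMap.rTensor V (LinearMap.mulLeft ℂ y) z
      = LinearMap.rTensor V (LinearMap.mulLeft ℂ y) z') : z = z' := by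
  rw [← sub_eq_zero]
  refine eq_zero_of_forall_rTensor (LinearMap.mulLeft ℂ) (fun w hw => h.right w hw) _ fun y => ?_
  rw [map_sub, hz, sub_self]

variable [IsScalarTower ℂ A A] [SMulCommClass ℂ A A]

variable {B C : Type*} [NonUnitalRing B] [Module ℂ B] [IsScalarTower ℂ B B] [SMulCommClass ℂ B B]
  [NonUnitalRing C] [Module ℂ C] [IsScalarTower ℂ C C] [SMulCommClass ℂ C C]

theorem mul_tmul_eq_map (z : B ⊗[ℂ] C) (b : B) (c : C) :
    z * b ⊗ₜ c = TensorProduct.map (LinearMap.mulRight ℂ b) (LinearMap.mulRight ℂ c) z := by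
  induction z with
  | zero => simp
  | add x y hx hy => simp only [add_mul, map_add, hx, hy]
  | tmul x y => simp

theorem tmul_mul_eq_map (z : B ⊗[ℂ] C) (b : B) (c : C) :
    b ⊗ₜ c * z = TensorProduct.map (LinearMap.mulLeft ℂ b) (LinearMap.mulLeft ℂ c) z := by
  induction z with
  | zero => simp
  | add x y hx hy => simp only [mul_add, map_add, hx, hy]
  | tmul x y => simp

theorem IsNondegenerate.eq_zero_of_mul_tmul (hB : IsNondegenerate B) (hC : IsNondegenerate C)
    {z : B ⊗[ℂ] C} (hz : ∀ b c, z * b ⊗ₜ c = 0) : z = 0 := by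
  refine eq_zero_of_forall_lTensor (LinearMap.mulRight ℂ) (fun w hw => hC.left w hw) _ fun c => ?_
  refine eq_zero_of_forall_rTensor (LinearMap.mulRight ℂ) (fun w hw => hB.left w hw) _ fun b => ?_
  rw [← hz b c, mul_tmul_eq_map, LinearMap.rTensor, LinearMap.lTensor, ← LinearMap.comp_apply,
    ← TensorProduct.map_comp]
  simp

theorem IsNondegenerate.eq_zero_of_tmul_mul (hB : IsNondegenerate B) (hC : IsNondegenerate C)
    {z : B ⊗[ℂ] C} (hz : ∀ b c, b ⊗ₜ c * z = 0) : z = 0 := by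
  refine eq_zero_of_forall_lTensor (LinearMap.mulLeft ℂ) (fun w hw => hC.right w hw) _ fun c => ?_
  refine eq_zero_of_forall_rTensor (LinearMap.mulLeft ℂ) (fun w hw => hB.right w hw) _ fun b => ?_
  rw [← hz b c, tmul_mul_eq_map, LinearMap.rTensor, LinearMap.lTensor, ← LinearMap.comp_apply,
    ← TensorProduct.map_comp]
  simp

theorem assoc_mul (z w : (A ⊗[ℂ] A) ⊗[ℂ] A) :
    TensorProduct.assoc ℂ A A A (z * w)
      = TensorProduct.assoc ℂ A A A z * TensorProduct.assoc ℂ A A A w := by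
  induction z with
  | zero => simp
  | add x y hx hy => simp only [add_mul, map_add, hx, hy]
  | tmul p q =>
  induction p with
  | zero => simp
  | add x y hx hy => simp only [TensorProduct.add_tmul, add_mul, map_add, hx, hy]
  | tmul p p' =>
  induction w with
  | zero => simp
  | add x y hx hy => simp only [mul_add, map_add, hx, hy]
  | tmul r s =>
  induction r with
  | zero => simp
  | add x y hx hy => simp only [TensorProduct.add_tmul, mul_add, map_add, hx, hy]
  | tmul r r' => simp

theorem IsNondegenerate.multiplier_ext_lmul (h : IsNondegenerate B) {m n : MultiplierAlg B}
    (hmn : ∀ x, m.lmul x = n.lmul x) : m = n := by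
  refine MultiplierAlg.ext' hmn fun x => ?_
  rw [← sub_eq_zero]
  refine h.left _ fun y => ?_
  rw [sub_mul, MultiplierAlg.rmul_mul_eq, MultiplierAlg.rmul_mul_eq, hmn, sub_self]

theorem IsNondegenerate.multiplier_ext_rmul (h : IsNondegenerate B) {m n : MultiplierAlg B}
    (hmn : ∀ x, m.rmul x = n.rmul x) : m = n := by
  refine MultiplierAlg.ext' (fun x => ?_) hmn
  rw [← sub_eq_zero]
  refine h.right _ fun y => ?_
  rw [mul_sub, ← MultiplierAlg.rmul_mul_eq, ← MultiplierAlg.rmul_mul_eq, hmn, sub_self]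

end Separation

variable {A : Type*} [NonUnitalRing A] [Module ℂ A] [IsScalarTower ℂ A A] [SMulCommClass ℂ A A]
  {Δ : A →ₙₐ[ℂ] MultiplierAlg (A ⊗[ℂ] A)}

theorem lmul_inFst (b : A) : (inFst b).lmul = LinearMap.rTensor A (LinearMap.mulLeft ℂ b) := rfl

theorem rmul_inFst (b : A) : (inFst b).rmul = LinearMap.rTensor A (LinearMap.mulRight ℂ b) := rfl

theorem lmul_inSnd (b : A) : (inSnd b).lmul = LinearMap.lTensor A (LinearMap.mulLeft ℂ b) := rfl

theorem rmul_inSnd (b : A) : (inSnd b).rmul = LinearMap.lTensor A (LinearMap.mulRight ℂ b) := rfl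

theorem ofElem_mul {B : Type*} [NonUnitalRing B] [Module ℂ B] [IsScalarTower ℂ B B]
    [SMulCommClass ℂ B B] (x y : B) :
    MultiplierAlg.ofElem (x * y) = MultiplierAlg.ofElem x * MultiplierAlg.ofElem y :=
  MultiplierAlg.ext' (fun z => by simp [mul_assoc]) (fun z => by simp [mul_assoc])

theorem ofElem_tmul (x y : A) :
    MultiplierAlg.ofElem (x ⊗ₜ[ℂ] y) = inFst x * inSnd y := by
  refine MultiplierAlg.ext' (fun z => ?_) (fun z => ?_) <;>
  · induction z with
    | zero => simp
    | add x y hx hy => simp only [map_add, hx, hy]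
    | tmul x y => simp [inFst, inSnd]

namespace IsRegularMultiplierHopf

/-! ### The Galois maps and the comultiplication -/

variable (h : IsRegularMultiplierHopf Δ)

theorem lmul_comul_tmul (a x y : A) :
    (Δ a).lmul (x ⊗ₜ y) = (inFst x).rmul (h.T₂ (a ⊗ₜ y)) := by
  apply h.nondegenerate.tensor.ofElem_injective
  rw [h.nondegenerate.tensor.ofElem_rmul, h.nondegenerate.tensor.ofElem_lmul, ofElem_T₂,
    mapT₂_tmul, ofElem_tmul, inFst_mul_inSnd, mul_assoc]

theorem lmul_comul_tmul' (a x y : A) :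
    (Δ a).lmul (x ⊗ₜ y) = (inSnd y).rmul (h.T₁ (a ⊗ₜ x)) := by
  apply h.nondegenerate.tensor.ofElem_injective
  rw [h.nondegenerate.tensor.ofElem_rmul, h.nondegenerate.tensor.ofElem_lmul, ofElem_T₁,
    mapT₁_tmul, ofElem_tmul, mul_assoc]

theorem rmul_comul_tmul (a x y : A) :
    (Δ a).rmul (x ⊗ₜ y) = (inFst x).lmul (h.T₄ (a ⊗ₜ y)) := by
  apply h.nondegenerate.tensor.ofElem_injective
  rw [h.nondegenerate.tensor.ofElem_rmul, h.nondegenerate.tensor.ofElem_lmul, ofElem_T₄,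
    mapT₄_tmul, ofElem_tmul, mul_assoc]

theorem rmul_comul_tmul' (a x y : A) :
    (Δ a).rmul (x ⊗ₜ y) = (inSnd y).lmul (h.T₃ (a ⊗ₜ x)) := by
  rw [rmul_comul_tmul, lmul_T₃]

theorem lmul_comul_T₂ (a p q : A) : (Δ a).lmul (h.T₂ (p ⊗ₜ q)) = h.T₂ ((a * p) ⊗ₜ q) := by
  apply h.nondegenerate.tensor.ofElem_injective
  rw [h.nondegenerate.tensor.ofElem_lmul, ofElem_T₂, ofElem_T₂, mapT₂_tmul, mapT₂_tmul,
    map_mul, mul_assoc]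

theorem lmul_comul_T₁ (a p q : A) : (Δ a).lmul (h.T₁ (p ⊗ₜ q)) = h.T₁ ((a * p) ⊗ₜ q) := by
  apply h.nondegenerate.tensor.ofElem_injective
  rw [h.nondegenerate.tensor.ofElem_lmul, ofElem_T₁, ofElem_T₁, mapT₁_tmul, mapT₁_tmul,
    map_mul, mul_assoc]

theorem rmul_comul_T₄ (a p q : A) : (Δ a).rmul (h.T₄ (p ⊗ₜ q)) = h.T₄ ((p * a) ⊗ₜ q) := by
  apply h.nondegenerate.tensor.ofElem_injective
  rw [h.nondegenerate.tensor.ofElem_rmul, ofElem_T₄, ofElem_T₄, mapT₄_tmul, mapT₄_tmul,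
    map_mul, mul_assoc]

theorem T₁_bijective : Function.Bijective h.T₁ := by
  refine ⟨fun x y hxy => ?_, fun z => ?_⟩
  · apply h.bijOn_T₁.injOn (Set.mem_univ _) (Set.mem_univ _)
    rw [← ofElem_T₁ h, ← ofElem_T₁ h, hxy]
  · obtain ⟨w, -, hw⟩ := h.bijOn_T₁.surjOn ⟨z, rfl⟩
    exact ⟨w, h.nondegenerate.tensor.ofElem_injective (by rw [ofElem_T₁, hw])⟩

theorem T₂_bijective : Function.Bijective h.T₂ := by
  refine ⟨fun x y hxy => ?_, fun z => ?_⟩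
  · apply h.bijOn_T₂.injOn (Set.mem_univ _) (Set.mem_univ _)
    rw [← ofElem_T₂ h, ← ofElem_T₂ h, hxy]
  · obtain ⟨w, -, hw⟩ := h.bijOn_T₂.surjOn ⟨z, rfl⟩
    exact ⟨w, h.nondegenerate.tensor.ofElem_injective (by rw [ofElem_T₂, hw])⟩

theorem T₃_bijective : Function.Bijective h.T₃ := by
  refine ⟨fun x y hxy => ?_, fun z => ?_⟩
  · apply h.bijOn_T₃.injOn (Set.mem_univ _) (Set.mem_univ _)
    rw [← ofElem_T₃ h, ← ofElem_T₃ h, hxy]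
  · obtain ⟨w, -, hw⟩ := h.bijOn_T₃.surjOn ⟨z, rfl⟩
    exact ⟨w, h.nondegenerate.tensor.ofElem_injective (by rw [ofElem_T₃, hw])⟩

theorem T₄_bijective : Function.Bijective h.T₄ := by
  refine ⟨fun x y hxy => ?_, fun z => ?_⟩
  · apply h.bijOn_T₄.injOn (Set.mem_univ _) (Set.mem_univ _)
    rw [← ofElem_T₄ h, ← ofElem_T₄ h, hxy]
  · obtain ⟨w, -, hw⟩ := h.bijOn_T₄.surjOn ⟨z, rfl⟩
    exact ⟨w, h.nondegenerate.tensor.ofElem_injective (by rw [ofElem_T₄, hw])⟩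

/-- `T₁` as an automorphism of the vector space `A ⊙ A`. -/
def equivT₁ : A ⊗[ℂ] A ≃ₗ[ℂ] A ⊗[ℂ] A :=
  LinearEquiv.ofBijective h.T₁ h.T₁_bijective

/-- `T₂` as an automorphism of the vector space `A ⊙ A`. -/
def equivT₂ : A ⊗[ℂ] A ≃ₗ[ℂ] A ⊗[ℂ] A :=
  LinearEquiv.ofBijective h.T₂ h.T₂_bijective

/-- `T₃` as an automorphism of the vector space `A ⊙ A`. -/
def equivT₃ : A ⊗[ℂ] A ≃ₗ[ℂ] A ⊗[ℂ] A :=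
  LinearEquiv.ofBijective h.T₃ h.T₃_bijective

/-- The map `a ↦ Δ(a)(c ⊗ 1)`. -/
def T₁At (c : A) : A →ₗ[ℂ] A ⊗[ℂ] A :=
  h.T₁ ∘ₗ (TensorProduct.mk ℂ A A).flip c

/-- The map `a ↦ Δ(a)(1 ⊗ c)`. -/
def T₂At (c : A) : A →ₗ[ℂ] A ⊗[ℂ] A :=
  h.T₂ ∘ₗ (TensorProduct.mk ℂ A A).flip c

/-- The map `a ↦ (c ⊗ 1)Δ(a)`. -/
def T₃At (c : A) : A →ₗ[ℂ] A ⊗[ℂ] A :=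
  h.T₃ ∘ₗ (TensorProduct.mk ℂ A A).flip c

/-- The map `a ↦ (1 ⊗ c)Δ(a)`. -/
def T₄At (c : A) : A →ₗ[ℂ] A ⊗[ℂ] A :=
  h.T₄ ∘ₗ (TensorProduct.mk ℂ A A).flip c

@[simp] theorem T₁At_apply (a c : A) :
    h.T₁At c a = h.T₁ (a ⊗ₜ c) := rfl

@[simp] theorem T₂At_apply (a c : A) :
    h.T₂At c a = h.T₂ (a ⊗ₜ c) := rfl

@[simp] theorem T₃At_apply (a c : A) :
    h.T₃At c a = h.T₃ (a ⊗ₜ c) := rfl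

@[simp] theorem T₄At_apply (a c : A) :
    h.T₄At c a = h.T₄ (a ⊗ₜ c) := rfl

end IsRegularMultiplierHopf

/-! ### Coassociativity as an identity in the triple tensor product -/

@[simp] theorem comulTensorId_tmul (x y : A) :
    comulTensorId Δ (x ⊗ₜ y) = (Δ x).tmul (MultiplierAlg.ofElem y) := by
  simp [comulTensorId]

@[simp] theorem idTensorComul_tmul (x y : A) :
    idTensorComul Δ (x ⊗ₜ y) = (MultiplierAlg.ofElem x).tmul (Δ y) := by
  simp [idTensorComul]

theorem tmul_mul_tmul {B C : Type*} [NonUnitalRing B] [Module ℂ B] [IsScalarTower ℂ B B]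
    [SMulCommClass ℂ B B] [NonUnitalRing C] [Module ℂ C] [IsScalarTower ℂ C C]
    [SMulCommClass ℂ C C] (m m' : MultiplierAlg B) (n n' : MultiplierAlg C) :
    m.tmul n * m'.tmul n' = (m * m').tmul (n * n') := by
  refine MultiplierAlg.ext' (fun z => ?_) (fun z => ?_) <;>
  · induction z with
    | zero => simp
    | add x y hx hy => simp only [map_add, hx, hy]
    | tmul x y => simp

theorem comulTensorId_mul_tmul (z : A ⊗[ℂ] A) (x y : A) :
    comulTensorId Δ z * comulTensorId Δ (x ⊗ₜ y) = comulTensorId Δ (z * x ⊗ₜ y) := by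
  induction z with
  | zero => simp
  | add u v hu hv => simp only [map_add, add_mul, hu, hv]
  | tmul u v => simp [tmul_mul_tmul, ofElem_mul]

theorem tmul_mul_idTensorComul (z : A ⊗[ℂ] A) (x y : A) :
    idTensorComul Δ (x ⊗ₜ y) * idTensorComul Δ z = idTensorComul Δ (x ⊗ₜ y * z) := by
  induction z with
  | zero => simp
  | add u v hu hv => simp only [map_add, mul_add, hu, hv]
  | tmul u v => simp [tmul_mul_tmul, ofElem_mul]

/-- `mul_assoc` for the multiplication that is inferred on `(A ⊙ A) ⊙ A`; the two instance paths agree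
only after unfolding, so that rewriting with `mul_assoc` itself does not apply. -/
theorem mul_assoc_tensorLeft (x y z : (A ⊗[ℂ] A) ⊗[ℂ] A) : x * y * z = x * (y * z) :=
  mul_assoc x y z

theorem mul_assoc_tensorRight (x y z : A ⊗[ℂ] (A ⊗[ℂ] A)) : x * y * z = x * (y * z) :=
  mul_assoc x y z

theorem lTensor_rTensor_comm {V W V' W' : Type*} [AddCommGroup V] [Module ℂ V] [AddCommGroup W]
    [Module ℂ W] [AddCommGroup V'] [Module ℂ V'] [AddCommGroup W'] [Module ℂ W']
    (f : V →ₗ[ℂ] V') (g : W →ₗ[ℂ] W') (z : V ⊗[ℂ] W) :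
    LinearMap.lTensor V' g (LinearMap.rTensor W f z)
      = LinearMap.rTensor W' f (LinearMap.lTensor V g z) :=
  LinearMap.congr_fun
    ((LinearMap.lTensor_comp_rTensor _ f g).trans (LinearMap.rTensor_comp_lTensor _ f g).symm) z

namespace IsRegularMultiplierHopf

variable (h : IsRegularMultiplierHopf Δ)

theorem span_lmul_induction (h : IsRegularMultiplierHopf Δ) {P : A ⊗[ℂ] A → Prop}
    (zero : P 0)
    (add : ∀ x y, P x → P y → P (x + y)) (smul : ∀ (c : ℂ) x, P x → P (c • x))
    (lmul : ∀ a z, P ((Δ a).lmul z)) (z : A ⊗[ℂ] A) : P z := by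
  have hz : z ∈ Submodule.span ℂ {y | ∃ (a : A) (x : A ⊗[ℂ] A), y = (Δ a).lmul x} := by
    rw [h.span_lmul]; trivial
  induction hz using Submodule.span_induction with
  | zero => exact zero
  | add x y _ _ hx hy => exact add x y hx hy
  | smul c x _ hx => exact smul c x hx
  | mem x hx => obtain ⟨a, y, rfl⟩ := hx; exact lmul a y

theorem span_rmul_induction (h : IsRegularMultiplierHopf Δ) {P : A ⊗[ℂ] A → Prop}
    (zero : P 0)
    (add : ∀ x y, P x → P y → P (x + y)) (smul : ∀ (c : ℂ) x, P x → P (c • x))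
    (rmul : ∀ a z, P ((Δ a).rmul z)) (z : A ⊗[ℂ] A) : P z := by
  have hz : z ∈ Submodule.span ℂ {y | ∃ (a : A) (x : A ⊗[ℂ] A), y = (Δ a).rmul x} := by
    rw [h.span_rmul]; trivial
  induction hz using Submodule.span_induction with
  | zero => exact zero
  | add x y _ _ hx hy => exact add x y hx hy
  | smul c x _ hx => exact smul c x hx
  | mem x hx => obtain ⟨a, y, rfl⟩ := hx; exact rmul a y

/-- The non-degeneracy of `Δ` reduces the test of an element of `(A ⊙ A) ⊙ A` against all right
factors to the factors in the range of `Δ ⊙ ι`. -/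
theorem eq_zero_of_mul_comulTensorId (h : IsRegularMultiplierHopf Δ) {z : (A ⊗[ℂ] A) ⊗[ℂ] A}
    (hz : ∀ x y w, z * (comulTensorId Δ (x ⊗ₜ y)).lmul w = 0) : z = 0 := by
  refine h.nondegenerate.tensor.eq_zero_of_mul_tmul h.nondegenerate fun s y => ?_
  refine h.nondegenerate.tensor.eq_zero_of_mul_tmul h.nondegenerate fun r t => ?_
  refine (mul_assoc_tensorLeft _ _ _).trans ?_
  rw [Algebra.TensorProduct.tmul_mul_tmul]
  generalize s * r = s
  induction s using h.span_lmul_induction with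
  | zero => simp
  | add a b ha hb => rw [TensorProduct.add_tmul, mul_add, ha, hb, add_zero]
  | smul c a ha => rw [← TensorProduct.smul_tmul', mul_smul_comm, ha, smul_zero]
  | lmul a w => simpa using hz a y (w ⊗ₜ t)

theorem eq_zero_of_idTensorComul_mul (h : IsRegularMultiplierHopf Δ) {z : A ⊗[ℂ] (A ⊗[ℂ] A)}
    (hz : ∀ x y w, (idTensorComul Δ (x ⊗ₜ y)).rmul w * z = 0) : z = 0 := by
  refine h.nondegenerate.eq_zero_of_tmul_mul h.nondegenerate.tensor fun y s => ?_
  refine h.nondegenerate.eq_zero_of_tmul_mul h.nondegenerate.tensor fun t r => ?_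
  refine (mul_assoc_tensorRight _ _ _).symm.trans ?_
  rw [Algebra.TensorProduct.tmul_mul_tmul]
  generalize r * s = s
  induction s using h.span_rmul_induction with
  | zero => simp
  | add a b ha hb => rw [TensorProduct.tmul_add, add_mul, ha, hb, add_zero]
  | smul c a ha => rw [TensorProduct.tmul_smul, smul_mul_assoc, ha, smul_zero]
  | rmul a w => simpa using hz y a (t ⊗ₜ w)

theorem T₂_mul (a c x y : A) : h.T₂ (a ⊗ₜ c) * x ⊗ₜ y = (Δ a).lmul (x ⊗ₜ (c * y)) := by
  rw [lmul_comul_tmul h]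
  apply h.nondegenerate.tensor.ofElem_injective
  rw [ofElem_mul, ofElem_T₂, h.nondegenerate.tensor.ofElem_rmul, ofElem_T₂,
    mapT₂_tmul, mapT₂_tmul, ofElem_tmul, inFst_mul_inSnd, mul_assoc, mul_assoc]
  congr 1
  rw [← mul_assoc]
  congr 1
  refine MultiplierAlg.ext' (fun z => ?_) (fun z => ?_) <;>
  · induction z with
    | zero => simp
    | add x y hx hy => simp only [map_add, hx, hy]
    | tmul x y => simp [inSnd, mul_assoc]

theorem tmul_mul_T₃ (a c x y : A) : x ⊗ₜ y * h.T₃ (a ⊗ₜ c) = (Δ a).rmul ((x * c) ⊗ₜ y) := by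
  apply h.nondegenerate.tensor.ofElem_injective
  rw [ofElem_mul, ofElem_T₃, h.nondegenerate.tensor.ofElem_rmul, mapT₃_tmul, ← mul_assoc]
  congr 1
  refine MultiplierAlg.ext' (fun z => ?_) (fun z => ?_) <;>
  · induction z with
    | zero => simp
    | add x y hx hy => simp only [map_add, hx, hy]
    | tmul x y => simp [inFst, mul_assoc]

theorem T₃_mul (p a : A) (s : A ⊗[ℂ] A) :
    h.T₃ (p ⊗ₜ a) * s = (inFst a).lmul ((Δ p).lmul s) := by
  rw [← MultiplierAlg.lmul_ofElem, ofElem_T₃, mapT₃_tmul, MultiplierAlg.lmul_mul]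

theorem mul_T₂ (p c : A) (s : A ⊗[ℂ] A) :
    s * h.T₂ (p ⊗ₜ c) = (inSnd c).rmul ((Δ p).rmul s) := by
  rw [← MultiplierAlg.rmul_ofElem, ofElem_T₂, mapT₂_tmul, MultiplierAlg.rmul_mul]

theorem rTensor_T₃At_mul (a : A) (z : A ⊗[ℂ] A) (w : (A ⊗[ℂ] A) ⊗[ℂ] A) :
    LinearMap.rTensor A (h.T₃At a) z * w
      = ((inFst a).tmul (1 : MultiplierAlg A)).lmul ((comulTensorId Δ z).lmul w) := by
  induction z with
  | zero => simp
  | add u v hu hv => simp only [map_add, add_mul, hu, hv, MultiplierAlg.lmul_add]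
  | tmul u v =>
    induction w with
    | zero => simp
    | add r s hr hs => simp only [map_add, mul_add, hr, hs]
    | tmul r s => simp [T₃_mul]

theorem mul_lTensor_T₂At (c : A) (z : A ⊗[ℂ] A) (w : A ⊗[ℂ] (A ⊗[ℂ] A)) :
    w * LinearMap.lTensor A (h.T₂At c) z
      = ((1 : MultiplierAlg A).tmul (inSnd c)).rmul ((idTensorComul Δ z).rmul w) := by
  induction z with
  | zero => simp; rfl
  | add u v hu hv => simp only [map_add, mul_add, hu, hv, MultiplierAlg.rmul_add]
  | tmul u v =>
    induction w with
    | zero => simp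
    | add r s hr hs => simp only [map_add, add_mul, hr, hs]
    | tmul r s => simp [mul_T₂]

/-- Coassociativity in the form
`(a ⊗ 1 ⊗ 1)(Δ ⊙ ι)(Δ(b)(1 ⊗ c)) = (ι ⊙ Δ)((a ⊗ 1)Δ(b))(1 ⊗ 1 ⊗ c)`. -/
theorem coassoc_T₃_T₂ (a b c : A) :
    TensorProduct.assoc ℂ A A A (LinearMap.rTensor A (h.T₃At a) (h.T₂ (b ⊗ₜ c)))
      = LinearMap.lTensor A (h.T₂At c) (h.T₃ (b ⊗ₜ a)) := by
  obtain ⟨n, n', hn, hn', hnn⟩ := h.coassoc b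
  set X := LinearMap.rTensor A (h.T₃At a) (h.T₂ (b ⊗ₜ c)) with hX
  set Y := LinearMap.lTensor A (h.T₂At c) (h.T₃ (b ⊗ₜ a)) with hY
  set M : MultiplierAlg ((A ⊗[ℂ] A) ⊗[ℂ] A) := (inFst a).tmul 1
  set N : MultiplierAlg ((A ⊗[ℂ] A) ⊗[ℂ] A) := (1 : MultiplierAlg (A ⊗[ℂ] A)).tmul
    (MultiplierAlg.ofElem c)
  set M' : MultiplierAlg (A ⊗[ℂ] (A ⊗[ℂ] A)) := (MultiplierAlg.ofElem a).tmul 1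
  set N' : MultiplierAlg (A ⊗[ℂ] (A ⊗[ℂ] A)) := (1 : MultiplierAlg A).tmul (inSnd c)
  -- `w X = w (a ⊗ 1 ⊗ 1) n (1 ⊗ 1 ⊗ c)`, where `n` is the value of `(Δ ⊙ ι)Δ` at `b`
  have e1 : ∀ w, w * X = N.rmul (n.rmul (M.rmul w)) := by
    intro w
    rw [← sub_eq_zero]
    refine h.eq_zero_of_mul_comulTensorId fun x y w' => ?_
    rw [sub_mul, sub_eq_zero, mul_assoc_tensorLeft, hX, rTensor_T₃At_mul, MultiplierAlg.rmul_mul_eq,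
      MultiplierAlg.rmul_mul_eq, MultiplierAlg.rmul_mul_eq]
    congr 2
    rw [← MultiplierAlg.lmul_mul, comulTensorId_mul_tmul, T₂_mul, ← (hn _).1]
    simp only [MultiplierAlg.lmul_mul]
    congr 1
    rw [← MultiplierAlg.lmul_mul]
    congr 1
    simp [N, tmul_mul_tmul, ofElem_mul]
  -- `w Y` is computed in the same way from `n'`, and `n`, `n'` correspond by coassociativity
  rw [← sub_eq_zero]
  refine h.eq_zero_of_idTensorComul_mul fun x y w => ?_
  rw [mul_sub, sub_eq_zero, hY, mul_lTensor_T₂At,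
    ← MultiplierAlg.rmul_mul (idTensorComul Δ (x ⊗ₜ y)) (idTensorComul Δ _),
    tmul_mul_idTensorComul, tmul_mul_T₃, ← (hn' _).2]
  obtain ⟨w, rfl⟩ := (TensorProduct.assoc ℂ A A A).surjective w
  obtain ⟨v, hv⟩ := (TensorProduct.assoc ℂ A A A).surjective
    ((idTensorComul Δ (x ⊗ₜ[ℂ] y)).rmul (TensorProduct.assoc ℂ A A A w))
  have hM : ∀ v, TensorProduct.assoc ℂ A A A (M.rmul v)
      = M'.rmul (TensorProduct.assoc ℂ A A A v) := by
    intro v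
    induction v with
    | zero => simp
    | add u v hu hv => simp only [map_add, hu, hv]
    | tmul u v =>
      induction u with
      | zero => simp
      | add u v hu hv => simp only [TensorProduct.add_tmul, map_add, hu, hv]
      | tmul r s => simp [M, M', inFst]
  have hN : ∀ v, TensorProduct.assoc ℂ A A A (N.rmul v)
      = N'.rmul (TensorProduct.assoc ℂ A A A v) := by
    intro v
    induction v with
    | zero => simp
    | add u v hu hv => simp only [map_add, hu, hv]
    | tmul u v =>
      induction u with
      | zero => simp
      | add u v hu hv => simp only [TensorProduct.add_tmul, map_add, hu, hv]
      | tmul r s => simp [N, N', inSnd]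
  rw [← hv, ← assoc_mul, e1, hN, (hnn _).2, hM, hv, MultiplierAlg.rmul_mul]
  congr 2
  rw [← MultiplierAlg.rmul_mul]
  congr 1
  simp [M', tmul_mul_tmul, ofElem_mul]

theorem lTensor_mulRight_T₄At (y c p : A) :
    LinearMap.lTensor A (LinearMap.mulRight ℂ y) (h.T₄At c p)
      = LinearMap.lTensor A (LinearMap.mulLeft ℂ c) (h.T₂At y p) := h.rmul_T₄ p c y

theorem rTensor_mulLeft_T₁At (y a p : A) :
    LinearMap.rTensor A (LinearMap.mulLeft ℂ y) (h.T₁At a p)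
      = LinearMap.rTensor A (LinearMap.mulRight ℂ a) (h.T₃At y p) := (h.rmul_T₃ p y a).symm

/-- Coassociativity covered by `a ⊗ 1 ⊗ 1` and `1 ⊗ 1 ⊗ c` on the left. It follows from the previous
form after multiplication by `1 ⊗ 1 ⊗ y` on the right, since `((1 ⊗ c)Δ(b))(1 ⊗ y)` equals
`(1 ⊗ c)(Δ(b)(1 ⊗ y))`. -/
theorem coassoc_T₃_T₄ (a b c : A) :
    TensorProduct.assoc ℂ A A A (LinearMap.rTensor A (h.T₃At a) (h.T₄ (b ⊗ₜ c)))
      = LinearMap.lTensor A (h.T₄At c) (h.T₃ (b ⊗ₜ a)) := by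
  have nat (g : A →ₗ[ℂ] A) (z : A ⊗[ℂ] A) :
      LinearMap.lTensor A (LinearMap.lTensor A g)
        (TensorProduct.assoc ℂ A A A (LinearMap.rTensor A (h.T₃At a) z))
      = TensorProduct.assoc ℂ A A A (LinearMap.rTensor A (h.T₃At a) (LinearMap.lTensor A g z)) := by
    rw [← lTensor_rTensor_comm, LinearMap.lTensor_tensor]
    simp
  apply (TensorProduct.assoc ℂ A A A).symm.injective
  refine h.nondegenerate.eq_of_lTensor_mulRight fun y => ?_
  apply (TensorProduct.assoc ℂ A A A).injective
  simp only [LinearMap.lTensor_tensor, LinearMap.comp_apply, LinearEquiv.coe_coe,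
    LinearEquiv.apply_symm_apply]
  rw [nat, ← T₄At_apply, lTensor_mulRight_T₄At, ← nat, T₂At_apply, coassoc_T₃_T₂,
    ← LinearMap.lTensor_comp_apply, ← LinearMap.lTensor_comp_apply]
  congr 2
  exact LinearMap.ext fun p => (h.lTensor_mulRight_T₄At y c p).symm

/-- A coassociativity relation whose first leg is covered on the left can be covered on the right
instead. -/
theorem coassoc_T₁_of_T₃ (P : A →ₗ[ℂ] A ⊗[ℂ] A)
    (hP : ∀ a b, TensorProduct.assoc ℂ A A A (LinearMap.rTensor A (h.T₃At a) (P b))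
      = LinearMap.lTensor A P (h.T₃ (b ⊗ₜ a))) (a b : A) :
    TensorProduct.assoc ℂ A A A (LinearMap.rTensor A (h.T₁At a) (P b))
      = LinearMap.lTensor A P (h.T₁ (b ⊗ₜ a)) := by
  have nat (g : A →ₗ[ℂ] A) (z : (A ⊗[ℂ] A) ⊗[ℂ] A) :
      LinearMap.rTensor (A ⊗[ℂ] A) g (TensorProduct.assoc ℂ A A A z)
      = TensorProduct.assoc ℂ A A A (LinearMap.rTensor A (LinearMap.rTensor A g) z) := by
    rw [LinearMap.rTensor_tensor]
    simp
  refine h.nondegenerate.eq_of_rTensor_mulLeft fun y => ?_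
  rw [nat, ← LinearMap.rTensor_comp_apply, ← lTensor_rTensor_comm, ← T₁At_apply,
    rTensor_mulLeft_T₁At, lTensor_rTensor_comm, T₃At_apply, ← hP, nat,
    ← LinearMap.rTensor_comp_apply]
  congr 3
  exact LinearMap.ext fun p => h.rTensor_mulLeft_T₁At y a p

end IsRegularMultiplierHopf

/-! ### Convolution operators and the Galois maps -/

theorem lTensor_sliceSnd_assoc_rTensor {V : Type*} [AddCommGroup V] [Module ℂ V]
    (φ : Module.Dual ℂ V) (g : V →ₗ[ℂ] V ⊗[ℂ] V)
    (z : V ⊗[ℂ] V) :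
    LinearMap.lTensor V (sliceSnd φ)
        (TensorProduct.assoc ℂ V V V (LinearMap.rTensor V g z))
      = g (sliceSnd φ z) := by
  induction z with
  | zero => simp
  | add u v hu hv => simp only [map_add, hu, hv]
  | tmul u v =>
    simp only [LinearMap.rTensor_tmul, sliceSnd_tmul, map_smul]
    induction g u with
    | zero => simp
    | add r s hr hs => simp only [TensorProduct.add_tmul, map_add, hr, hs, smul_add]
    | tmul r s => simp

theorem rTensor_sliceFst_assoc_symm_lTensor {V : Type*} [AddCommGroup V] [Module ℂ V]
    (φ : Module.Dual ℂ V) (g : V →ₗ[ℂ] V ⊗[ℂ] V)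
    (z : V ⊗[ℂ] V) :
    LinearMap.rTensor V (sliceFst φ)
        ((TensorProduct.assoc ℂ V V V).symm (LinearMap.lTensor V g z))
      = g (sliceFst φ z) := by
  induction z with
  | zero => simp
  | add u v hu hv => simp only [map_add, hu, hv]
  | tmul u v =>
    simp only [LinearMap.lTensor_tmul, sliceFst_tmul, map_smul]
    induction g v with
    | zero => simp
    | add r s hr hs => simp only [TensorProduct.tmul_add, map_add, hr, hs, smul_add]
    | tmul r s => simp [TensorProduct.smul_tmul']

namespace IsRegularMultiplierHopf

variable (h : IsRegularMultiplierHopf Δ)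

/-- The operator `a ↦ (ι ⊙ φ)(Δ(a)(1 ⊗ x))`, that is, `a ↦ (ι ⊙ φ(· x))Δ(a)`. -/
def sliceT₂ (φ : Module.Dual ℂ A) (x : A) : A →ₗ[ℂ] A := sliceSnd φ ∘ₗ h.T₂At x

/-- The operator `x ↦ (ι ⊙ φ)((1 ⊗ a)Δ(x))`, that is, `x ↦ (ι ⊙ φ(a ·))Δ(x)`. -/
def sliceT₄ (φ : Module.Dual ℂ A) (a : A) : A →ₗ[ℂ] A := sliceSnd φ ∘ₗ h.T₄At a

/-- The operator `x ↦ (φ ⊙ ι)((a ⊗ 1)Δ(x))`, that is, `x ↦ (φ(a ·) ⊙ ι)Δ(x)`. -/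
def sliceT₃ (φ : Module.Dual ℂ A) (a : A) : A →ₗ[ℂ] A := sliceFst φ ∘ₗ h.T₃At a

theorem sliceT₂_apply (φ : Module.Dual ℂ A) (x a : A) :
    h.sliceT₂ φ x a = sliceSnd φ (h.T₂ (a ⊗ₜ x)) := rfl

theorem sliceT₄_apply (φ : Module.Dual ℂ A) (a x : A) :
    h.sliceT₄ φ a x = sliceSnd φ (h.T₄ (x ⊗ₜ a)) := rfl

theorem sliceT₃_apply (φ : Module.Dual ℂ A) (a x : A) :
    h.sliceT₃ φ a x = sliceFst φ (h.T₃ (x ⊗ₜ a)) := rfl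

theorem lTensor_sliceSnd_T₃ (φ : Module.Dual ℂ A) (P : A →ₗ[ℂ] A ⊗[ℂ] A)
    (hP : ∀ a b, TensorProduct.assoc ℂ A A A (LinearMap.rTensor A (h.T₃At a) (P b))
      = LinearMap.lTensor A P (h.T₃ (b ⊗ₜ a))) (w : A ⊗[ℂ] A) :
    LinearMap.lTensor A (sliceSnd φ ∘ₗ P) (h.T₃ w)
      = h.T₃ (LinearMap.rTensor A (sliceSnd φ ∘ₗ P) w) := by
  induction w with
  | zero => simp
  | add u v hu hv => simp only [map_add, hu, hv]
  | tmul b a =>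
    rw [LinearMap.lTensor_comp, LinearMap.comp_apply, ← hP, lTensor_sliceSnd_assoc_rTensor]
    rfl

theorem lTensor_sliceSnd_T₁ (φ : Module.Dual ℂ A) (P : A →ₗ[ℂ] A ⊗[ℂ] A)
    (hP : ∀ a b, TensorProduct.assoc ℂ A A A (LinearMap.rTensor A (h.T₃At a) (P b))
      = LinearMap.lTensor A P (h.T₃ (b ⊗ₜ a))) (w : A ⊗[ℂ] A) :
    LinearMap.lTensor A (sliceSnd φ ∘ₗ P) (h.T₁ w)
      = h.T₁ (LinearMap.rTensor A (sliceSnd φ ∘ₗ P) w) := by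
  induction w with
  | zero => simp
  | add u v hu hv => simp only [map_add, hu, hv]
  | tmul b a =>
    rw [LinearMap.lTensor_comp, LinearMap.comp_apply, ← h.coassoc_T₁_of_T₃ P hP,
      lTensor_sliceSnd_assoc_rTensor]
    rfl

theorem lTensor_sliceT₂_T₃ (φ : Module.Dual ℂ A) (x : A) (w : A ⊗[ℂ] A) :
    LinearMap.lTensor A (h.sliceT₂ φ x) (h.T₃ w) = h.T₃ (LinearMap.rTensor A (h.sliceT₂ φ x) w) :=
  h.lTensor_sliceSnd_T₃ φ _ (fun a b => h.coassoc_T₃_T₂ a b x) w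

theorem lTensor_sliceT₄_T₃ (φ : Module.Dual ℂ A) (x : A) (w : A ⊗[ℂ] A) :
    LinearMap.lTensor A (h.sliceT₄ φ x) (h.T₃ w) = h.T₃ (LinearMap.rTensor A (h.sliceT₄ φ x) w) :=
  h.lTensor_sliceSnd_T₃ φ _ (fun a b => h.coassoc_T₃_T₄ a b x) w

theorem lTensor_sliceT₂_T₁ (φ : Module.Dual ℂ A) (x : A) (w : A ⊗[ℂ] A) :
    LinearMap.lTensor A (h.sliceT₂ φ x) (h.T₁ w) = h.T₁ (LinearMap.rTensor A (h.sliceT₂ φ x) w) :=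
  h.lTensor_sliceSnd_T₁ φ _ (fun a b => h.coassoc_T₃_T₂ a b x) w

theorem lTensor_sliceT₄_T₁ (φ : Module.Dual ℂ A) (x : A) (w : A ⊗[ℂ] A) :
    LinearMap.lTensor A (h.sliceT₄ φ x) (h.T₁ w) = h.T₁ (LinearMap.rTensor A (h.sliceT₄ φ x) w) :=
  h.lTensor_sliceSnd_T₁ φ _ (fun a b => h.coassoc_T₃_T₄ a b x) w

theorem rTensor_sliceT₃_T₂ (φ : Module.Dual ℂ A) (a x b : A) :
    LinearMap.rTensor A (h.sliceT₃ φ a) (h.T₂ (x ⊗ₜ b)) = h.T₂ (h.sliceT₃ φ a x ⊗ₜ b) := by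
  rw [sliceT₃, LinearMap.rTensor_comp, LinearMap.comp_apply,
    ← (TensorProduct.assoc ℂ A A A).symm_apply_apply (LinearMap.rTensor A _ _), coassoc_T₃_T₂,
    rTensor_sliceFst_assoc_symm_lTensor]
  rfl

end IsRegularMultiplierHopf

namespace IsRegularMultiplierHopf

variable (h : IsRegularMultiplierHopf Δ)

/-! ### The counit -/

/-- `(c ⊗ 1) T₂(w)` in terms of `T₃`: on `w = p ⊗ q` this is `((c ⊗ 1)Δ(p))(1 ⊗ q)`. -/
theorem mul'_lTensor_rTensor_T₃At (c : A) (w : A ⊗[ℂ] A) :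
    LinearMap.lTensor A (LinearMap.mul' ℂ A)
        (TensorProduct.assoc ℂ A A A (LinearMap.rTensor A (h.T₃At c) w))
      = LinearMap.rTensor A (LinearMap.mulLeft ℂ c) (h.T₂ w) := by
  induction w with
  | zero => simp
  | add u v hu hv => simp only [map_add, hu, hv]
  | tmul p q =>
    have e : LinearMap.rTensor A (LinearMap.mulLeft ℂ c) (h.T₂ (p ⊗ₜ q))
        = LinearMap.lTensor A (LinearMap.mulRight ℂ q) (h.T₃ (p ⊗ₜ c)) := (h.rmul_T₃' p c q).symm
    rw [e, LinearMap.rTensor_tmul, T₃At_apply]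
    induction h.T₃ (p ⊗ₜ c) with
    | zero => simp
    | add r s hr hs => simp only [TensorProduct.add_tmul, map_add, hr, hs]
    | tmul r s => simp

theorem lTensor_mul'_equivT₂_symm (a b c : A) :
    LinearMap.lTensor A (LinearMap.mul' ℂ A ∘ₗ h.equivT₂.symm.toLinearMap ∘ₗ
        (TensorProduct.mk ℂ A A).flip b) (h.T₃ (a ⊗ₜ c)) = (c * a) ⊗ₜ b := by
  obtain ⟨w, hw⟩ := h.T₂_bijective.2 (a ⊗ₜ b)
  -- `T₂⁻¹` may be applied in the last two legs, by coassociativity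
  have key : LinearMap.lTensor A h.T₂
      (TensorProduct.assoc ℂ A A A (LinearMap.rTensor A (h.T₃At c) w))
      = LinearMap.lTensor A ((TensorProduct.mk ℂ A A).flip b) (h.T₃ (a ⊗ₜ c)) := by
    have : ∀ w, LinearMap.lTensor A h.T₂
        (TensorProduct.assoc ℂ A A A (LinearMap.rTensor A (h.T₃At c) w))
        = TensorProduct.assoc ℂ A A A (LinearMap.rTensor A (h.T₃At c) (h.T₂ w)) := by
      intro w
      induction w with
      | zero => simp
      | add u v hu hv => simp only [map_add, hu, hv]
      | tmul p q =>
        rw [coassoc_T₃_T₂, LinearMap.rTensor_tmul, T₃At_apply]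
        induction h.T₃ (p ⊗ₜ c) with
        | zero => simp
        | add r s hr hs => simp only [TensorProduct.add_tmul, map_add, hr, hs]
        | tmul r s => simp
    rw [this, hw, LinearMap.rTensor_tmul, T₃At_apply]
    induction h.T₃ (a ⊗ₜ c) with
    | zero => simp
    | add r s hr hs => simp only [TensorProduct.add_tmul, map_add, hr, hs]
    | tmul r s => simp
  have inv : h.equivT₂.symm.toLinearMap ∘ₗ h.T₂ = LinearMap.id :=
    LinearMap.ext fun z => h.equivT₂.symm_apply_apply z
  rw [LinearMap.lTensor_comp_apply, LinearMap.lTensor_comp_apply, ← key,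
    ← LinearMap.lTensor_comp_apply A h.equivT₂.symm.toLinearMap, inv, LinearMap.lTensor_id,
    LinearMap.id_apply, mul'_lTensor_rTensor_T₃At, hw]
  simp

/-- There is a linear functional `ε` that satisfies the two counit equations. It is read off from
`m T₂⁻¹(a ⊗ b) = ε(a) b`. -/
theorem exists_counit_functional :
    ∃ ε : Module.Dual ℂ A, (∀ w, sliceFst ε (h.T₂ w) = LinearMap.mul' ℂ A w) ∧
      ∀ a c, sliceSnd ε (h.T₃ (a ⊗ₜ c)) = c * a := by
  by_cases hA : ∀ b : A, b = 0
  · exact ⟨0, fun w => (hA _).trans (hA _).symm, fun a c => (hA _).trans (hA _).symm⟩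
  push Not at hA
  obtain ⟨r, hr⟩ := hA
  obtain ⟨f, hf⟩ : ∃ f : Module.Dual ℂ A, f r ≠ 0 := by
    by_contra! hf
    exact hr ((Module.forall_dual_apply_eq_zero_iff ℂ r).1 hf)
  let E (b : A) : A →ₗ[ℂ] A := LinearMap.mul' ℂ A ∘ₗ h.equivT₂.symm.toLinearMap ∘ₗ
        (TensorProduct.mk ℂ A A).flip b
  let η : A ⊗[ℂ] A →ₗ[ℂ] A :=
    LinearMap.mul' ℂ A ∘ₗ (TensorProduct.comm ℂ A A).toLinearMap ∘ₗ h.equivT₃.symm.toLinearMap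
  have hη (a c : A) : η (h.T₃ (a ⊗ₜ c)) = c * a := by
    have : h.equivT₃.symm (h.T₃ (a ⊗ₜ c)) = a ⊗ₜ c := h.equivT₃.symm_apply_apply _
    simp [η, this]
  have hE (b : A) (z : A ⊗[ℂ] A) : LinearMap.lTensor A (E b) z = η z ⊗ₜ b := by
    obtain ⟨w, rfl⟩ := h.T₃_bijective.2 z
    induction w with
    | zero => simp
    | add u v hu hv => simp only [map_add, hu, hv, TensorProduct.add_tmul]
    | tmul a c => rw [hη, ← lTensor_mul'_equivT₂_symm]
  let ε : Module.Dual ℂ A := (f r)⁻¹ • (f ∘ₗ η ∘ₗ TensorProduct.mk ℂ A A r)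
  have hε (a b : A) : E b a = ε a • b := by
    have := congrArg (sliceFst f) (hE b (r ⊗ₜ a))
    rw [LinearMap.lTensor_tmul, sliceFst_tmul, sliceFst_tmul] at this
    simp only [ε, LinearMap.smul_apply, LinearMap.comp_apply, TensorProduct.mk_apply, smul_eq_mul,
      mul_smul]
    rw [← this, smul_smul, inv_mul_cancel₀ hf, one_smul]
  refine ⟨ε, fun w => ?_, fun a c => ?_⟩
  · have : ∀ z, sliceFst ε z = LinearMap.mul' ℂ A (h.equivT₂.symm z) := by
      intro z
      induction z with
      | zero => simp
      | add u v hu hv => simp only [map_add, hu, hv]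
      | tmul a b => rw [sliceFst_tmul, ← hε]; rfl
    rw [this]
    exact congrArg _ (h.equivT₂.symm_apply_apply w)
  · have e : ∀ z, LinearMap.lTensor A (E r) z = sliceSnd ε z ⊗ₜ r := by
      intro z
      induction z with
      | zero => simp
      | add u v hu hv => simp only [map_add, hu, hv, TensorProduct.add_tmul]
      | tmul a b => rw [LinearMap.lTensor_tmul, hε, sliceSnd_tmul, TensorProduct.smul_tmul]
    have := congrArg (sliceSnd f) ((e (h.T₃ (a ⊗ₜ c))).symm.trans (hE r _))
    rw [sliceSnd_tmul, sliceSnd_tmul, hη] at this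
    exact smul_right_injective A hf this

theorem counit_functional_mul {ε : Module.Dual ℂ A}
    (hε : ∀ w, sliceFst ε (h.T₂ w) = LinearMap.mul' ℂ A w) (a b : A) : ε (a * b) = ε a * ε b := by
  have h1 : ∀ (d : A) (z : A ⊗[ℂ] A), sliceFst ε ((Δ d).lmul z) = d * sliceFst ε z := by
    intro d z
    obtain ⟨w, rfl⟩ := h.T₂_bijective.2 z
    induction w with
    | zero => simp
    | add u v hu hv => simp only [map_add, hu, hv, mul_add]
    | tmul p q => rw [lmul_comul_T₂, hε, hε]; simp [mul_assoc]
  have h2 : ∀ z : A ⊗[ℂ] A, sliceFst ε ((inFst b).rmul z) = ε b • sliceFst ε z := by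
    intro z
    obtain ⟨w, rfl⟩ := h.T₂_bijective.2 z
    induction w with
    | zero => simp
    | add u v hu hv => simp only [map_add, hu, hv, smul_add]
    | tmul p q => rw [← lmul_comul_tmul, h1, hε]; simp [mul_smul_comm]
  by_cases hA : ∀ s : A, s = 0
  · rw [hA (a * b), hA a]; simp
  push Not at hA
  obtain ⟨s, hs⟩ := hA
  have := h2 (a ⊗ₜ s)
  rw [rmul_inFst, LinearMap.rTensor_tmul, sliceFst_tmul, sliceFst_tmul, smul_smul,
    LinearMap.mulRight_apply] at this
  rw [smul_left_injective ℂ hs this, mul_comm]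

theorem isCounit_of_slices {ε : A →ₙₐ[ℂ] ℂ} (hA : ∃ a : A, a ≠ 0)
    (h2 : ∀ w, sliceFst (ε : A →ₗ[ℂ] ℂ) (h.T₂ w) = LinearMap.mul' ℂ A w)
    (h3 : ∀ a c, sliceSnd (ε : A →ₗ[ℂ] ℂ) (h.T₃ (a ⊗ₜ c)) = c * a) : h.IsCounit ε where
  ne_zero h0 := by
    obtain ⟨a, ha⟩ := hA
    refine ha (h.nondegenerate.left a fun b => ?_)
    rw [← LinearMap.mul'_apply (R := ℂ), ← h2, h0]
    simp [sliceFst, show (((0 : A →ₙₐ[ℂ] ℂ) : A →ₗ[ℂ] ℂ)) = 0 from rfl]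
  sliceFst_eq a := h.nondegenerate.multiplier_ext_lmul fun x => by
    rw [lmul_comulSliceFst, h2]; simp
  sliceSnd_eq a := h.nondegenerate.multiplier_ext_rmul fun x => by
    rw [rmul_comulSliceSnd, h3]; simp

theorem exists_isCounit (hA : ∃ a : A, a ≠ 0) : ∃ ε : A →ₙₐ[ℂ] ℂ, h.IsCounit ε := by
  obtain ⟨ε, h2, h3⟩ := h.exists_counit_functional
  let ε' : A →ₙₐ[ℂ] ℂ :=
    { ε with
      map_zero' := map_zero ε
      map_mul' := h.counit_functional_mul h2 }
  exact ⟨ε', h.isCounit_of_slices hA h2 h3⟩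

namespace IsCounit

variable {h} {ε : A →ₙₐ[ℂ] ℂ}
theorem sliceFst_T₂ (hε : h.IsCounit ε) (w : A ⊗[ℂ] A) :
    sliceFst (ε : A →ₗ[ℂ] ℂ) (h.T₂ w) = LinearMap.mul' ℂ A w := by
  induction w with
  | zero => simp
  | add u v hu hv => simp only [map_add, hu, hv]
  | tmul p q => rw [← lmul_comulSliceFst, hε.sliceFst_eq]; simp

theorem sliceSnd_T₃ (hε : h.IsCounit ε) (a c : A) : sliceSnd (ε : A →ₗ[ℂ] ℂ) (h.T₃ (a ⊗ₜ c)) = c * a := by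
  rw [← rmul_comulSliceSnd, hε.sliceSnd_eq]; simp

theorem sliceFst_T₄ (hε : h.IsCounit ε) (a c : A) : sliceFst (ε : A →ₗ[ℂ] ℂ) (h.T₄ (a ⊗ₜ c)) = c * a := by
  rw [← rmul_comulSliceFst, hε.sliceFst_eq]; simp

theorem unique (hε : h.IsCounit ε) {ε' : A →ₙₐ[ℂ] ℂ} (hε' : h.IsCounit ε')
    (hA : ∃ a : A, a ≠ 0) : ε' = ε := by
  have e : ∀ z : A ⊗[ℂ] A, sliceSnd (ε' : A →ₗ[ℂ] ℂ) z = sliceSnd (ε : A →ₗ[ℂ] ℂ) z := by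
    intro z
    obtain ⟨w, rfl⟩ := h.T₃_bijective.2 z
    induction w with
    | zero => simp
    | add u v hu hv => simp only [map_add, hu, hv]
    | tmul p q => rw [hε.sliceSnd_T₃, hε'.sliceSnd_T₃]
  obtain ⟨r, hr⟩ := hA
  ext a
  have := e (r ⊗ₜ a)
  rw [sliceSnd_tmul, sliceSnd_tmul] at this
  exact smul_left_injective ℂ hr this

end IsCounit

end IsRegularMultiplierHopf

/-! ### Strong left invariance and the antipode -/

theorem sliceSnd_surjective {V : Type*} [AddCommGroup V] [Module ℂ V] {φ : Module.Dual ℂ V}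
    (hφ0 : φ ≠ 0) : Function.Surjective (sliceSnd φ) := by
  obtain ⟨e, he⟩ : ∃ e, φ e ≠ 0 := by
    by_contra! he
    exact hφ0 (LinearMap.ext he)
  exact fun a => ⟨a ⊗ₜ ((φ e)⁻¹ • e), by simp [he]⟩

theorem sliceFst_surjective {V : Type*} [AddCommGroup V] [Module ℂ V] {φ : Module.Dual ℂ V}
    (hφ0 : φ ≠ 0) : Function.Surjective (sliceFst φ) := by
  obtain ⟨e, he⟩ : ∃ e, φ e ≠ 0 := by
    by_contra! he
    exact hφ0 (LinearMap.ext he)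
  exact fun a => ⟨((φ e)⁻¹ • e) ⊗ₜ a, by simp [he]⟩

namespace IsRegularMultiplierHopf

variable (h : IsRegularMultiplierHopf Δ)

theorem IsCounit.sliceT₂ {h : IsRegularMultiplierHopf Δ} {ε : A →ₙₐ[ℂ] ℂ} (hε : h.IsCounit ε)
    (φ : Module.Dual ℂ A) (x a : A) : ε (h.sliceT₂ φ x a) = φ (a * x) := by
  have := apply_sliceSnd (ε : A →ₗ[ℂ] ℂ) φ (h.T₂ (a ⊗ₜ x))
  rwa [hε.sliceFst_T₂, LinearMap.mul'_apply] at this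

theorem IsCounit.sliceT₄ {h : IsRegularMultiplierHopf Δ} {ε : A →ₙₐ[ℂ] ℂ} (hε : h.IsCounit ε)
    (φ : Module.Dual ℂ A) (a x : A) : ε (h.sliceT₄ φ a x) = φ (a * x) := by
  have := apply_sliceSnd (ε : A →ₗ[ℂ] ℂ) φ (h.T₄ (x ⊗ₜ a))
  rwa [hε.sliceFst_T₄] at this

variable {h} {φ : Module.Dual ℂ A} {ε : A →ₙₐ[ℂ] ℂ}

theorem IsLeftInvariant.sliceSnd_T₃ (hφ : h.IsLeftInvariant φ) (a b : A) :
    sliceSnd φ (h.T₃ (a ⊗ₜ b)) = φ a • b := by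
  rw [← rmul_comulSliceSnd, hφ]; simp

theorem IsLeftInvariant.sliceSnd_T₁ (hφ : h.IsLeftInvariant φ) (a b : A) :
    sliceSnd φ (h.T₁ (a ⊗ₜ b)) = φ a • b := by
  rw [← lmul_comulSliceSnd, hφ]; simp

/-- Strong left invariance: `b (ι ⊙ φ)((1 ⊗ a)Δ(x))` is computed by writing `b ⊗ a` as a sum of
terms `(q ⊗ 1)Δ(p)`. -/
theorem IsLeftInvariant.mul_sliceT₄ (hφ : h.IsLeftInvariant φ) {a b : A} {w : A ⊗[ℂ] A}
    (hw : h.T₃ w = b ⊗ₜ a) (x : A) :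
    b * h.sliceT₄ φ a x = sliceFst (φ ∘ₗ LinearMap.mulRight ℂ x) w := by
  rw [sliceT₄_apply, ← sliceSnd_lmul_inFst, ← rmul_comul_tmul, ← hw]
  clear hw
  induction w with
  | zero => simp
  | add u v hu hv => simp only [map_add, hu, hv]
  | tmul p q => rw [rmul_comul_T₃, hφ.sliceSnd_T₃]; simp

/-- Strong left invariance: `(ι ⊙ φ)(Δ(a)(1 ⊗ x)) b` is computed by writing `b ⊗ x` as a sum of
terms `Δ(p)(q ⊗ 1)`. -/
theorem IsLeftInvariant.sliceT₂_mul (hφ : h.IsLeftInvariant φ) {x b : A} {w : A ⊗[ℂ] A}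
    (hw : h.T₁ w = b ⊗ₜ x) (a : A) :
    h.sliceT₂ φ x a * b = sliceFst (φ ∘ₗ LinearMap.mulLeft ℂ a) w := by
  rw [sliceT₂_apply, ← sliceSnd_rmul_inFst, ← lmul_comul_tmul, ← hw]
  clear hw
  induction w with
  | zero => simp
  | add u v hu hv => simp only [map_add, hu, hv]
  | tmul p q => rw [lmul_comul_T₁, hφ.sliceSnd_T₁]; simp

theorem IsCounit.sliceFst_mulRight (hε : h.IsCounit ε) (φ : Module.Dual ℂ A) (x : A)
    (w : A ⊗[ℂ] A) : sliceFst (φ ∘ₗ LinearMap.mulRight ℂ x) w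
      = sliceFst (ε : A →ₗ[ℂ] ℂ) (LinearMap.rTensor A (h.sliceT₂ φ x) w) := by
  induction w with
  | zero => simp
  | add u v hu hv => simp only [map_add, hu, hv]
  | tmul p q => simp [hε.sliceT₂]

theorem IsCounit.sliceFst_mulLeft (hε : h.IsCounit ε) (φ : Module.Dual ℂ A) (a : A)
    (w : A ⊗[ℂ] A) : sliceFst (φ ∘ₗ LinearMap.mulLeft ℂ a) w
      = sliceFst (ε : A →ₗ[ℂ] ℂ) (LinearMap.rTensor A (h.sliceT₄ φ a) w) := by
  induction w with
  | zero => simp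
  | add u v hu hv => simp only [map_add, hu, hv]
  | tmul p q => simp [hε.sliceT₄]

theorem IsLeftInvariant.mul_sliceT₄_eq (hφ : h.IsLeftInvariant φ) (hε : h.IsCounit ε)
    (a b x : A) : b * h.sliceT₄ φ a x
      = sliceFst (ε : A →ₗ[ℂ] ℂ) (h.equivT₃.symm (b ⊗ₜ h.sliceT₂ φ x a)) := by
  obtain ⟨w, hw⟩ := h.T₃_bijective.2 (b ⊗ₜ a)
  rw [hφ.mul_sliceT₄ hw, hε.sliceFst_mulRight]
  congr 1
  rw [LinearEquiv.eq_symm_apply]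
  change h.T₃ _ = _
  rw [← lTensor_sliceT₂_T₃, hw, LinearMap.lTensor_tmul]

theorem IsLeftInvariant.sliceT₂_mul_eq (hφ : h.IsLeftInvariant φ) (hε : h.IsCounit ε)
    (a b x : A) : h.sliceT₂ φ x a * b
      = sliceFst (ε : A →ₗ[ℂ] ℂ) (h.equivT₁.symm (b ⊗ₜ h.sliceT₄ φ a x)) := by
  obtain ⟨w, hw⟩ := h.T₁_bijective.2 (b ⊗ₜ x)
  rw [hφ.sliceT₂_mul hw, hε.sliceFst_mulLeft]
  congr 1
  rw [LinearEquiv.eq_symm_apply]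
  change h.T₁ _ = _
  rw [← lTensor_sliceT₄_T₁, hw, LinearMap.lTensor_tmul]

/-- A linear automorphism `S` of `A` with `S((ι ⊙ φ)(Δ(a)(1 ⊗ x))) = (ι ⊙ φ)((1 ⊗ a)Δ(x))`; for a
non-zero left invariant `φ` this is the antipode. -/
def IsAntipode (h : IsRegularMultiplierHopf Δ) (φ : Module.Dual ℂ A) (S : A ≃ₗ[ℂ] A) : Prop :=
  ∀ a x, S (h.sliceT₂ φ x a) = h.sliceT₄ φ a x

/-- The antipode exists: the operator `(ι ⊙ φ)(Δ(a)(1 ⊗ x)) ↦ (ι ⊙ φ)((1 ⊗ a)Δ(x))` is well defined and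
bijective by strong left invariance. -/
theorem IsLeftInvariant.exists_antipode (hφ : h.IsLeftInvariant φ) (hφ0 : φ ≠ 0)
    (hε : h.IsCounit ε) : ∃ S : A ≃ₗ[ℂ] A, h.IsAntipode φ S := by
  let U : A ⊗[ℂ] A →ₗ[ℂ] A := sliceSnd φ ∘ₗ h.T₂
  let V : A ⊗[ℂ] A →ₗ[ℂ] A := sliceSnd φ ∘ₗ h.T₄ ∘ₗ (TensorProduct.comm ℂ A A).toLinearMap
  have hU : Function.Surjective U := (sliceSnd_surjective hφ0).comp h.T₂_bijective.2
  have hV : Function.Surjective V := (sliceSnd_surjective hφ0).comp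
    (h.T₄_bijective.2.comp (TensorProduct.comm ℂ A A).surjective)
  have hUV : ∀ (b : A) (z : A ⊗[ℂ] A),
      b * V z = sliceFst (ε : A →ₗ[ℂ] ℂ) (h.equivT₃.symm (b ⊗ₜ U z)) := by
    intro b z
    induction z with
    | zero => simp
    | add u v hu hv => simp only [map_add, mul_add, TensorProduct.tmul_add, hu, hv]
    | tmul a x => exact hφ.mul_sliceT₄_eq hε a b x
  have hVU : ∀ (b : A) (z : A ⊗[ℂ] A),
      U z * b = sliceFst (ε : A →ₗ[ℂ] ℂ) (h.equivT₁.symm (b ⊗ₜ V z)) := by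
    intro b z
    induction z with
    | zero => simp
    | add u v hu hv => simp only [map_add, add_mul, TensorProduct.tmul_add, hu, hv]
    | tmul a x => exact hφ.sliceT₂_mul_eq hε a b x
  have kU : ∀ z, U z = 0 → V z = 0 := fun z hz => h.nondegenerate.right _ fun b => by
    rw [hUV, hz]; simp
  have kV : ∀ z, V z = 0 → U z = 0 := fun z hz => h.nondegenerate.left _ fun b => by
    rw [hVU, hz]; simp
  obtain ⟨g, hg⟩ := U.exists_rightInverse_of_surjective (LinearMap.range_eq_top.2 hU)
  have hg' : ∀ a, U (g a) = a := fun a => LinearMap.congr_fun hg a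
  have hS : ∀ z, V (g (U z)) = V z := by
    intro z
    rw [← sub_eq_zero, ← map_sub]
    exact kU _ (by rw [map_sub, hg', sub_self])
  refine ⟨LinearEquiv.ofBijective (V ∘ₗ g) ⟨?_, fun b => ?_⟩, fun a x => hS (a ⊗ₜ x)⟩
  · rw [injective_iff_map_eq_zero]
    intro a ha
    rw [← hg' a]
    exact kV _ ha
  · obtain ⟨z, rfl⟩ := hV b
    exact ⟨U z, hS z⟩

theorem sliceT₂_span (hφ0 : φ ≠ 0) {P : A → Prop} (zero : P 0)
    (add : ∀ x y, P x → P y → P (x + y)) (slice : ∀ a x, P (h.sliceT₂ φ x a)) (a : A) : P a := by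
  obtain ⟨z, rfl⟩ := sliceSnd_surjective hφ0 a
  obtain ⟨w, rfl⟩ := h.T₂_bijective.2 z
  induction w with
  | zero => simpa using zero
  | add u v hu hv => simpa only [map_add] using add _ _ hu hv
  | tmul a x => exact slice a x

theorem sliceT₄_span (hφ0 : φ ≠ 0) {P : A → Prop} (zero : P 0)
    (add : ∀ x y, P x → P y → P (x + y)) (slice : ∀ a x, P (h.sliceT₄ φ a x)) (a : A) : P a := by
  obtain ⟨z, rfl⟩ := sliceSnd_surjective hφ0 a
  obtain ⟨w, rfl⟩ := h.T₄_bijective.2 z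
  induction w with
  | zero => simpa using zero
  | add u v hu hv => simpa only [map_add] using add _ _ hu hv
  | tmul x a => exact slice a x

theorem sliceT₃_span (hφ0 : φ ≠ 0) {P : A → Prop} (zero : P 0)
    (add : ∀ x y, P x → P y → P (x + y)) (slice : ∀ a x, P (h.sliceT₃ φ a x)) (a : A) : P a := by
  obtain ⟨z, rfl⟩ := sliceFst_surjective hφ0 a
  obtain ⟨w, rfl⟩ := h.T₃_bijective.2 z
  induction w with
  | zero => simpa using zero
  | add u v hu hv => simpa only [map_add] using add _ _ hu hv
  | tmul x a => exact slice a x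

namespace IsAntipode

variable {S : A ≃ₗ[ℂ] A}

theorem mul_apply (hS : h.IsAntipode φ S) (hφ : h.IsLeftInvariant φ) (hφ0 : φ ≠ 0)
    (hε : h.IsCounit ε) (b c : A) :
    b * S c = sliceFst (ε : A →ₗ[ℂ] ℂ) (h.equivT₃.symm (b ⊗ₜ c)) := by
  induction c using sliceT₂_span (h := h) hφ0 with
  | zero => simp
  | add x y hx hy => simp only [map_add, mul_add, TensorProduct.tmul_add, hx, hy]
  | slice a x => rw [hS, hφ.mul_sliceT₄_eq hε]

/-- The antipode is anti-multiplicative. If `b ⊗ y = ∑ (qᵢ ⊗ 1)Δ(pᵢ)` and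
`qᵢ ⊗ x = ∑ⱼ (qᵢⱼ ⊗ 1)Δ(pᵢⱼ)`, then `b ⊗ x y = ∑ (qᵢⱼ ⊗ 1)Δ(pᵢⱼ pᵢ)`, so that applying the character
`ε` gives `b S(x y) = (b S(y)) S(x)`. -/
theorem map_mul (hS : h.IsAntipode φ S) (hφ : h.IsLeftInvariant φ) (hφ0 : φ ≠ 0)
    (hε : h.IsCounit ε) (x y : A) : S (x * y) = S y * S x := by
  have T₃_symm (z : A ⊗[ℂ] A) : h.T₃ (h.equivT₃.symm z) = z := h.equivT₃.apply_symm_apply z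
  have symm_T₃ (z : A ⊗[ℂ] A) : h.equivT₃.symm (h.T₃ z) = z := h.equivT₃.symm_apply_apply z
  rw [← sub_eq_zero]
  refine h.nondegenerate.right _ fun b => ?_
  rw [mul_sub, sub_eq_zero, ← mul_assoc, hS.mul_apply hφ hφ0 hε, hS.mul_apply hφ hφ0 hε,
    hS.mul_apply hφ hφ0 hε]
  obtain ⟨w, hw⟩ := h.T₃_bijective.2 (b ⊗ₜ y)
  have e : b ⊗ₜ (x * y) = (inSnd x).lmul (h.T₃ w) := by
    rw [hw, lmul_inSnd]; simp
  rw [e, ← hw, symm_T₃]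
  clear e hw
  induction w with
  | zero => simp
  | add u v hu hv => simp only [_root_.map_add, TensorProduct.add_tmul, hu, hv]
  | tmul p q =>
    have e : ∀ z, (Δ p).rmul (h.T₃ z) = h.T₃ (LinearMap.rTensor A (LinearMap.mulRight ℂ p) z) := by
      intro z
      induction z with
      | zero => simp
      | add u v hu hv => simp only [_root_.map_add, hu, hv]
      | tmul r s => rw [rmul_comul_T₃]; simp
    have e' : ∀ z : A ⊗[ℂ] A, sliceFst (ε : A →ₗ[ℂ] ℂ)
        (LinearMap.rTensor A (LinearMap.mulRight ℂ p) z)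
          = ε p • sliceFst (ε : A →ₗ[ℂ] ℂ) z := by
      intro z
      induction z with
      | zero => simp
      | add u v hu hv => simp only [_root_.map_add, smul_add, hu, hv]
      | tmul r s => simp [mul_comm (ε r), mul_smul]
    rw [← rmul_comul_tmul', ← T₃_symm (q ⊗ₜ x), e, symm_T₃, e', sliceFst_tmul,
      ← TensorProduct.smul_tmul', map_smul, map_smul]
    rfl

/-- The antipode reverses the comultiplication, covered by `c ⊗ 1` and `1 ⊗ x`: in Sweedler
notation, both sides are `c S(a₂) ⊗ a₁ x`. -/
theorem lTensor_symm_T₃ (hS : h.IsAntipode φ S) (hφ0 : φ ≠ 0) (a c x : A) :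
    LinearMap.lTensor A (LinearMap.mulRight ℂ x ∘ₗ S.symm.toLinearMap) (h.T₃ (S a ⊗ₜ c))
      = TensorProduct.comm ℂ A A (LinearMap.lTensor A (LinearMap.mulLeft ℂ c ∘ₗ S.toLinearMap)
          (h.T₁ (a ⊗ₜ x))) := by
  induction a using sliceT₂_span (h := h) hφ0 with
  | zero => simp
  | add x y hx hy => simp only [_root_.map_add, TensorProduct.add_tmul, hx, hy]
  | slice b y =>
  have e3 : h.T₃ (S (h.sliceT₂ φ y b) ⊗ₜ c)
      = LinearMap.lTensor A (h.sliceT₄ φ b) (h.T₃ (y ⊗ₜ c)) := by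
    rw [hS, lTensor_sliceT₄_T₃, LinearMap.rTensor_tmul]
  have e1 : h.T₁ (h.sliceT₂ φ y b ⊗ₜ x)
      = LinearMap.lTensor A (h.sliceT₂ φ y) (h.T₁ (b ⊗ₜ x)) := by
    rw [lTensor_sliceT₂_T₁, LinearMap.rTensor_tmul]
  -- both sides are bilinear expressions in `Δ(b)(x ⊗ 1)` and `(c ⊗ 1)Δ(y)`
  let f (W : A ⊗[ℂ] A) : A →ₗ[ℂ] A := sliceSnd φ ∘ₗ LinearMap.applyₗ W ∘ₗ
    LinearMap.lTensorHom A ∘ₗ (LinearMap.mul ℂ A).flip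
  let g (Z : A ⊗[ℂ] A) : A →ₗ[ℂ] A := sliceSnd φ ∘ₗ LinearMap.applyₗ Z ∘ₗ
    LinearMap.lTensorHom A ∘ₗ LinearMap.mul ℂ A
  have hf : LinearMap.mulRight ℂ x ∘ₗ S.symm.toLinearMap ∘ₗ h.sliceT₄ φ b = f (h.T₁ (b ⊗ₜ x)) := by
    ext t
    change S.symm (h.sliceT₄ φ b t) * x = sliceSnd φ ((inSnd t).rmul (h.T₁ (b ⊗ₜ x)))
    rw [← hS, S.symm_apply_apply, sliceT₂_apply, ← sliceSnd_rmul_inFst, ← lmul_comul_tmul,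
      lmul_comul_tmul']
  have hg : LinearMap.mulLeft ℂ c ∘ₗ S.toLinearMap ∘ₗ h.sliceT₂ φ y = g (h.T₃ (y ⊗ₜ c)) := by
    ext t
    change c * S (h.sliceT₂ φ y t) = sliceSnd φ ((inSnd t).lmul (h.T₃ (y ⊗ₜ c)))
    rw [hS, sliceT₄_apply, ← sliceSnd_lmul_inFst, ← rmul_comul_tmul, rmul_comul_tmul']
  have fg : ∀ W Z : A ⊗[ℂ] A, LinearMap.lTensor A (f W) Z
      = TensorProduct.comm ℂ A A (LinearMap.lTensor A (g Z) W) := by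
    intro W Z
    induction Z with
    | zero => simp [g]
    | add u v hu hv =>
      have : g (u + v) = g u + g v := by ext; simp [g]
      simp only [_root_.map_add, hu, hv, this, LinearMap.lTensor_add, LinearMap.add_apply]
    | tmul s t =>
      induction W with
      | zero => simp [f]
      | add u v hu hv =>
        have : f (u + v) = f u + f v := by ext; simp [f]
        simp only [_root_.map_add, this, LinearMap.lTensor_add, LinearMap.add_apply, hu, hv]
      | tmul r r' => simp [f, g]
  rw [e3, e1, ← LinearMap.lTensor_comp_apply, ← LinearMap.lTensor_comp_apply, LinearMap.comp_assoc,
    LinearMap.comp_assoc, hf, hg, fg]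

/-- The antipode reverses the comultiplication: `Δ(S(a)) = σ(S ⊙ S)Δ(a)`, covered by `S(x)`. -/
theorem T₃_map (hS : h.IsAntipode φ S) (hφ : h.IsLeftInvariant φ) (hφ0 : φ ≠ 0)
    (hε : h.IsCounit ε) (a x : A) :
    h.T₃ (S a ⊗ₜ S x) = TensorProduct.comm ℂ A A
      (TensorProduct.map S.toLinearMap S.toLinearMap (h.T₂ (a ⊗ₜ x))) := by
  have key : LinearMap.lTensor A S.symm.toLinearMap (h.T₃ (S a ⊗ₜ S x))
      = TensorProduct.comm ℂ A A (LinearMap.lTensor A S.toLinearMap (h.T₂ (a ⊗ₜ x))) := by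
    refine h.nondegenerate.eq_of_lTensor_mulRight fun y => ?_
    have e : LinearMap.mulLeft ℂ (S x) ∘ₗ S.toLinearMap
        = S.toLinearMap ∘ₗ LinearMap.mulRight ℂ x :=
      LinearMap.ext fun t => (hS.map_mul hφ hφ0 hε t x).symm
    have e' : LinearMap.lTensor A (LinearMap.mulRight ℂ x) (h.T₁ (a ⊗ₜ y))
        = LinearMap.rTensor A (LinearMap.mulRight ℂ y) (h.T₂ (a ⊗ₜ x)) := by
      rw [← rmul_inSnd, ← rmul_inFst, ← lmul_comul_tmul, ← lmul_comul_tmul']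
    rw [← LinearMap.lTensor_comp_apply, hS.lTensor_symm_T₃ hφ0, e, LinearMap.lTensor_comp_apply, e']
    generalize h.T₂ (a ⊗ₜ x) = z
    induction z with
    | zero => simp
    | add u v hu hv => simp only [_root_.map_add, hu, hv]
    | tmul r s => simp
  have := congrArg (LinearMap.lTensor A S.toLinearMap) key
  rw [← LinearMap.lTensor_comp_apply] at this
  have e : S.toLinearMap ∘ₗ S.symm.toLinearMap = LinearMap.id :=
    LinearMap.ext fun t => S.apply_symm_apply t
  rw [e, LinearMap.lTensor_id, LinearMap.id_apply] at this
  rw [this]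
  generalize h.T₂ (a ⊗ₜ x) = z
  induction z with
  | zero => simp
  | add u v hu hv => simp only [_root_.map_add, hu, hv]
  | tmul r s => simp

end IsAntipode

end IsRegularMultiplierHopf

/-! ### The right invariant functional -/

theorem sliceFst_comm_map {V : Type*} [AddCommGroup V] [Module ℂ V] (S : V ≃ₗ[ℂ] V)
    (φ : Module.Dual ℂ V) (z : V ⊗[ℂ] V) :
    sliceFst (φ ∘ₗ S.symm.toLinearMap)
        (TensorProduct.comm ℂ V V (TensorProduct.map S.toLinearMap S.toLinearMap z))
      = S (sliceSnd φ z) := by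
  induction z with
  | zero => simp
  | add u v hu hv => simp only [map_add, hu, hv]
  | tmul r s => simp

theorem sliceSnd_comm_map {V : Type*} [AddCommGroup V] [Module ℂ V] (S : V ≃ₗ[ℂ] V)
    (θ : Module.Dual ℂ V) (z : V ⊗[ℂ] V) :
    sliceSnd θ (TensorProduct.comm ℂ V V (TensorProduct.map S.toLinearMap S.toLinearMap z))
      = S (sliceFst (θ ∘ₗ S.toLinearMap) z) := by
  induction z with
  | zero => simp
  | add u v hu hv => simp only [map_add, hu, hv]
  | tmul r s => simp

theorem sliceSnd_lTensor {V : Type*} [AddCommGroup V] [Module ℂ V] (θ : Module.Dual ℂ V)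
    (g : V →ₗ[ℂ] V) (z : V ⊗[ℂ] V) :
    sliceSnd θ (LinearMap.lTensor V g z) = sliceSnd (θ ∘ₗ g) z := by
  induction z with
  | zero => simp
  | add u v hu hv => simp only [map_add, hu, hv]
  | tmul r s => simp

theorem sliceFst_lTensor {V : Type*} [AddCommGroup V] [Module ℂ V] (θ : Module.Dual ℂ V)
    (g : V →ₗ[ℂ] V) (z : V ⊗[ℂ] V) :
    sliceFst θ (LinearMap.lTensor V g z) = g (sliceFst θ z) := by
  induction z with
  | zero => simp
  | add u v hu hv => simp only [map_add, hu, hv]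
  | tmul r s => simp

theorem sliceFst_rTensor {V : Type*} [AddCommGroup V] [Module ℂ V] (θ : Module.Dual ℂ V)
    (g : V →ₗ[ℂ] V) (z : V ⊗[ℂ] V) :
    sliceFst θ (LinearMap.rTensor V g z) = sliceFst (θ ∘ₗ g) z := by
  induction z with
  | zero => simp
  | add u v hu hv => simp only [map_add, hu, hv]
  | tmul r s => simp

namespace IsRegularMultiplierHopf

variable {h : IsRegularMultiplierHopf Δ} {φ ψ : Module.Dual ℂ A} {ε : A →ₙₐ[ℂ] ℂ} {S : A ≃ₗ[ℂ] A}

/-- The antipode reverses the comultiplication: `Δ(S(a)) = σ(S ⊙ S)Δ(a)`, covered by `S(x)` in the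
second leg. -/
theorem IsAntipode.T₄_map (hS : h.IsAntipode φ S) (hφ : h.IsLeftInvariant φ) (hφ0 : φ ≠ 0)
    (hε : h.IsCounit ε) (a x : A) :
    h.T₄ (S a ⊗ₜ S x) = TensorProduct.comm ℂ A A
      (TensorProduct.map S.toLinearMap S.toLinearMap (h.T₁ (a ⊗ₜ x))) := by
  have hm := hS.map_mul hφ hφ0 hε
  refine h.nondegenerate.eq_of_rTensor_mulLeft fun y => ?_
  obtain ⟨y, rfl⟩ := S.surjective y
  have e : ∀ z : A ⊗[ℂ] A, LinearMap.lTensor A (LinearMap.mulLeft ℂ (S x))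
        (TensorProduct.comm ℂ A A (TensorProduct.map S.toLinearMap S.toLinearMap z))
      = TensorProduct.comm ℂ A A (TensorProduct.map S.toLinearMap S.toLinearMap
          (LinearMap.rTensor A (LinearMap.mulRight ℂ x) z)) := by
    intro z
    induction z with
    | zero => simp
    | add u v hu hv => simp only [map_add, hu, hv]
    | tmul r s => simp [hm]
  have e' : ∀ z : A ⊗[ℂ] A, LinearMap.rTensor A (LinearMap.mulLeft ℂ (S y))
        (TensorProduct.comm ℂ A A (TensorProduct.map S.toLinearMap S.toLinearMap z))
      = TensorProduct.comm ℂ A A (TensorProduct.map S.toLinearMap S.toLinearMap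
          (LinearMap.lTensor A (LinearMap.mulRight ℂ y) z)) := by
    intro z
    induction z with
    | zero => simp
    | add u v hu hv => simp only [map_add, hu, hv]
    | tmul r s => simp [hm]
  rw [← lmul_inFst, ← lmul_T₃, lmul_inSnd, hS.T₃_map hφ hφ0 hε, e, lmul_inFst, e', ← rmul_inFst,
    ← rmul_inSnd, ← lmul_comul_tmul, ← lmul_comul_tmul']

/-- `ψ = φ ∘ S⁻¹` is right invariant. -/
theorem IsAntipode.sliceFst_T₄ (hS : h.IsAntipode φ S) (hφ : h.IsLeftInvariant φ) (hφ0 : φ ≠ 0)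
    (hε : h.IsCounit ε) (a x : A) :
    sliceFst (φ ∘ₗ S.symm.toLinearMap) (h.T₄ (a ⊗ₜ x)) = (φ ∘ₗ S.symm.toLinearMap) a • x := by
  obtain ⟨a, rfl⟩ := S.surjective a
  obtain ⟨x, rfl⟩ := S.surjective x
  rw [hS.T₄_map hφ hφ0 hε, sliceFst_comm_map, hφ.sliceSnd_T₁]
  simp

/-- Evaluating `(ψ ⊙ φ)((a ⊗ b)Δ(x))` with `a ⊗ b = T₃(w) = T₄(w')`, by left invariance of `φ` and
by right invariance of `ψ`, exhibits functionals that lie both in `φ(A ·)` and in `ψ(A ·)`. -/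
theorem IsLeftInvariant.functionalMul_eq (hφ : h.IsLeftInvariant φ)
    (hψ : ∀ a x, sliceFst ψ (h.T₄ (a ⊗ₜ x)) = ψ a • x) {w w' : A ⊗[ℂ] A}
    (hw : h.T₃ w = h.T₄ w') :
    functionalMul φ (sliceSnd ψ w) = functionalMul ψ (sliceSnd φ w') := by
  ext x
  have e1 : ∀ w, ψ (sliceSnd φ ((Δ x).rmul (h.T₃ w))) = φ (sliceSnd ψ w * x) := by
    intro w
    induction w with
    | zero => simp
    | add u v hu hv => simp only [map_add, add_mul, hu, hv]
    | tmul p q => rw [rmul_comul_T₃, hφ.sliceSnd_T₃]; simp [mul_comm, smul_mul_assoc]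
  have e2 : ∀ w, ψ (sliceSnd φ ((Δ x).rmul (h.T₄ w))) = ψ (sliceSnd φ w * x) := by
    intro w
    induction w with
    | zero => simp
    | add u v hu hv => simp only [map_add, add_mul, hu, hv]
    | tmul p q => rw [rmul_comul_T₄, apply_sliceSnd, hψ]; simp [smul_mul_assoc, mul_comm (φ q)]
  change φ (sliceSnd ψ w * x) = ψ (sliceSnd φ w' * x)
  rw [← e1, ← e2, hw]

theorem IsLeftInvariant.dualSubspace_eq (hφ : h.IsLeftInvariant φ) (hφ0 : φ ≠ 0) (hψ0 : ψ ≠ 0)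
    (hψ : ∀ a x, sliceFst ψ (h.T₄ (a ⊗ₜ x)) = ψ a • x) : dualSubspace φ = dualSubspace ψ := by
  refine le_antisymm ?_ ?_
  · rintro _ ⟨a, rfl⟩
    obtain ⟨w, rfl⟩ := sliceSnd_surjective hψ0 a
    obtain ⟨w', hw⟩ := h.T₄_bijective.2 (h.T₃ w)
    exact ⟨sliceSnd φ w', (hφ.functionalMul_eq hψ hw.symm).symm⟩
  · rintro _ ⟨a, rfl⟩
    obtain ⟨w', rfl⟩ := sliceSnd_surjective hφ0 a
    obtain ⟨w, hw⟩ := h.T₃_bijective.2 (h.T₄ w')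
    exact ⟨sliceSnd ψ w, hφ.functionalMul_eq hψ hw⟩

/-! ### Faithfulness of the left invariant functional -/

/-- A non-zero functional does not vanish on all products, since `m = (ε ⊙ ι)T₂` is surjective. -/
theorem exists_mul_ne (hφ0 : φ ≠ 0) (hε : h.IsCounit ε) : ∃ x y, φ (x * y) ≠ 0 := by
  by_contra! H
  apply hφ0
  have hm : ∀ z : A ⊗[ℂ] A, φ (LinearMap.mul' ℂ A z) = 0 := by
    intro z
    induction z with
    | zero => simp
    | add u v hu hv => simp only [map_add, hu, hv, add_zero]
    | tmul p q => simpa using H p q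
  ext a
  obtain ⟨z, rfl⟩ := sliceFst_surjective (φ := (ε : A →ₗ[ℂ] ℂ))
    (fun h0 => hε.ne_zero (by ext a; exact LinearMap.congr_fun h0 a)) a
  obtain ⟨w, rfl⟩ := h.T₂_bijective.2 z
  rw [hε.sliceFst_T₂, hm]
  rfl

/-- A non-zero left invariant functional is faithful. If `φ(x a) = 0` for all `x`, strong left
invariance gives `b ε(a) ∈ {n | φ(x n) = 0 ∀ x}` for all `b`, hence `ε(a) = 0`; this applies to all
`(f ⊙ ι)((c ⊗ 1)Δ(a))` as well, so that `f(c a) = 0` for all functionals `f`. -/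
theorem IsAntipode.eq_zero_of_haar_mul (hS : h.IsAntipode φ S)
    (hφ0 : φ ≠ 0) (hε : h.IsCounit ε) {a : A} (ha : ∀ x, φ (x * a) = 0) : a = 0 := by
  have hT₂ : ∀ a, (∀ x, φ (x * a) = 0) → ∀ b, h.sliceT₂ φ a b = 0 := by
    intro a ha b
    rw [sliceT₂_apply]
    refine h.nondegenerate.left _ fun y => ?_
    rw [← sliceSnd_rmul_inFst, ← lmul_comul_tmul, lmul_comul_tmul' h]
    generalize h.T₁ (b ⊗ₜ y) = z
    rw [rmul_inSnd, sliceSnd_lTensor, show φ ∘ₗ LinearMap.mulRight ℂ a = 0 from LinearMap.ext ha]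
    simp only [sliceSnd, LinearMap.lTensor_zero, LinearMap.comp_zero, LinearMap.zero_apply]
  have hT₄ : ∀ a, (∀ x, φ (x * a) = 0) → ∀ b, h.sliceT₄ φ b a = 0 := by
    intro a ha b
    rw [← hS, hT₂ a ha, map_zero]
  have key : ∀ a, (∀ x, φ (x * a) = 0) → ε a = 0 := by
    intro a ha
    obtain ⟨y, c, hyc⟩ := exists_mul_ne (h := h) hφ0 hε
    obtain ⟨w, hw⟩ := h.T₃_bijective.2 (c ⊗ₜ a)
    have h1 : LinearMap.mul' ℂ A (TensorProduct.comm ℂ A A w) = ε a • c := by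
      have := congrArg (sliceSnd (ε : A →ₗ[ℂ] ℂ)) hw
      rw [sliceSnd_tmul] at this
      refine Eq.trans ?_ this
      clear hw this
      induction w with
      | zero => simp
      | add u v hu hv => simp only [map_add, hu, hv]
      | tmul p q => rw [hε.sliceSnd_T₃]; simp
    have h2 : ∀ b, sliceFst (φ ∘ₗ LinearMap.mulLeft ℂ b) w = 0 := by
      intro b
      rw [hε.sliceFst_mulLeft]
      have : h.T₃ (LinearMap.rTensor A (h.sliceT₄ φ b) w) = 0 := by
        rw [← lTensor_sliceT₄_T₃, hw, LinearMap.lTensor_tmul, hT₄ a ha, TensorProduct.tmul_zero]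
      rw [h.T₃_bijective.1 (this.trans (map_zero h.T₃).symm), map_zero]
    have h3 : φ (y * LinearMap.mul' ℂ A (TensorProduct.comm ℂ A A w)) = 0 := by
      obtain ⟨p, hp⟩ := TensorProduct.eq_repr_basis_right (Module.Basis.ofVectorSpace ℂ A) w
      have hp0 : ∀ i b, φ (b * p i) = 0 := by
        intro i b
        have := apply_sliceSnd (φ ∘ₗ LinearMap.mulLeft ℂ b)
          ((Module.Basis.ofVectorSpace ℂ A).coord i) w
        rw [h2, map_zero, ← hp, Finsupp.sum, map_sum] at this
        refine Eq.trans ?_ this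
        simp only [sliceSnd_tmul, Module.Basis.coord_apply, Module.Basis.repr_self]
        rw [Finset.sum_eq_single i]
        · simp
        · intro j _ hj
          rw [Finsupp.single_eq_of_ne' hj, zero_smul]
        · intro hi
          rw [Finsupp.notMem_support_iff.1 hi, smul_zero]
      rw [← hp, Finsupp.sum, map_sum, map_sum, Finset.mul_sum, map_sum]
      refine Finset.sum_eq_zero fun i _ => ?_
      rw [TensorProduct.comm_tmul, LinearMap.mul'_apply, ← mul_assoc, hp0]
    rw [h1, mul_smul_comm, map_smul, smul_eq_mul] at h3
    exact (mul_eq_zero.1 h3).resolve_right hyc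
  refine h.nondegenerate.right _ fun c => ?_
  rw [← Module.forall_dual_apply_eq_zero_iff ℂ]
  intro f
  have e := apply_sliceSnd f (ε : A →ₗ[ℂ] ℂ) (h.T₃ (a ⊗ₜ c))
  rw [hε.sliceSnd_T₃] at e
  rw [e]
  refine key _ fun x => ?_
  change (φ ∘ₗ LinearMap.mulLeft ℂ x) _ = 0
  rw [← apply_sliceSnd, ← sliceSnd_lmul_inSnd, lmul_T₃, sliceSnd_lmul_inFst, ← sliceT₄_apply,
    hT₄ a ha, mul_zero, map_zero]

end IsRegularMultiplierHopf

namespace IsRegularMultiplierHopf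

/-! ### Slices by functionals of the dual algebra -/

variable {h : IsRegularMultiplierHopf Δ} {φ : Module.Dual ℂ A} {ε : A →ₙₐ[ℂ] ℂ} {S : A ≃ₗ[ℂ] A}

theorem mul_sliceT₃ (φ : Module.Dual ℂ A) (a x y : A) :
    y * h.sliceT₃ φ a x = sliceFst (functionalMul φ a) (h.T₄ (x ⊗ₜ y)) := by
  rw [sliceT₃_apply, ← sliceFst_lmul_inSnd, lmul_T₃, sliceFst_lmul_inFst]
  rfl

theorem mul_sliceT₄ (φ : Module.Dual ℂ A) (a x y : A) :
    y * h.sliceT₄ φ a x = sliceSnd (functionalMul φ a) (h.T₃ (x ⊗ₜ y)) := by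
  rw [sliceT₄_apply, ← sliceSnd_lmul_inFst, ← lmul_T₃, sliceSnd_lmul_inSnd]
  rfl

theorem mul_elemSliceFst (θ : h.sliceSpace) (a x : A) :
    a * h.elemSliceFst θ x = sliceFst θ.1 (h.T₄ (x ⊗ₜ a)) := by
  rw [← rmul_comulSliceFst, ← ofElem_elemSliceFst, MultiplierAlg.rmul_ofElem]

theorem elemSliceSnd_eq_sliceT₄ {θ : h.sliceSpace} {a : A} (hθ : θ.1 = functionalMul φ a)
    (x : A) : h.elemSliceSnd θ x = h.sliceT₄ φ a x := by
  rw [← sub_eq_zero]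
  refine h.nondegenerate.right _ fun y => ?_
  rw [mul_sub, elemSliceSnd_mul, mul_sliceT₄, hθ, sub_self]

theorem elemSliceFst_eq_sliceT₃ {θ : h.sliceSpace} {a : A} (hθ : θ.1 = functionalMul φ a)
    (x : A) : h.elemSliceFst θ x = h.sliceT₃ φ a x := by
  rw [← sub_eq_zero]
  refine h.nondegenerate.right _ fun y => ?_
  rw [mul_sub, mul_elemSliceFst, mul_sliceT₃, hθ, sub_self]

theorem haar_mul_elemSliceSnd (φ : Module.Dual ℂ A) (θ : h.sliceSpace) (a x : A) :
    φ (a * h.elemSliceSnd θ x) = θ.1 (h.sliceT₃ φ a x) := by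
  rw [elemSliceSnd_mul, apply_sliceSnd, sliceT₃_apply]

theorem haar_mul_elemSliceFst (φ : Module.Dual ℂ A) (θ : h.sliceSpace) (a x : A) :
    φ (a * h.elemSliceFst θ x) = θ.1 (h.sliceT₄ φ a x) := by
  rw [mul_elemSliceFst, ← apply_sliceSnd, sliceT₄_apply]

theorem sliceT₃_sliceT₄ (φ φ' : Module.Dual ℂ A) (a b x : A) :
    h.sliceT₃ φ a (h.sliceT₄ φ' b x) = h.sliceT₄ φ' b (h.sliceT₃ φ a x) := by
  have := h.lTensor_sliceT₄_T₃ φ' b (x ⊗ₜ a)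
  rw [LinearMap.rTensor_tmul] at this
  rw [sliceT₃_apply, ← this, sliceFst_lTensor, sliceT₃_apply]

/-- `θ φ(a ·) = φ(d ·)` with `d = S⁻¹((ι ⊙ θ)Δ(S(a)))`. -/
theorem IsAntipode.comp_sliceT₄_mem (hS : h.IsAntipode φ S) (hφ : h.IsLeftInvariant φ)
    (hφ0 : φ ≠ 0) (hε : h.IsCounit ε) (θ : h.sliceSpace) (a : A) :
    θ.1 ∘ₗ h.sliceT₄ φ a ∈ dualSubspace φ := by
  refine ⟨S.symm (h.elemSliceSnd θ (S a)), LinearMap.ext fun x => ?_⟩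
  change φ (S.symm (h.elemSliceSnd θ (S a)) * x) = θ.1 (h.sliceT₄ φ a x)
  have e := apply_sliceSnd (θ.1 ∘ₗ S.toLinearMap) φ (h.T₂ (a ⊗ₜ x))
  rw [← hS]
  refine Eq.trans ?_ e.symm
  congr 1
  apply S.injective
  rw [hS.map_mul hφ hφ0 hε, S.apply_symm_apply, elemSliceSnd_mul, hS.T₃_map hφ hφ0 hε,
    sliceSnd_comm_map]

/-- `ψ(b ·) θ = ψ(d ·)` with `ψ = φ ∘ S⁻¹` and `d = S((θ ⊙ ι)Δ(S⁻¹(b)))`. -/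
theorem IsAntipode.comp_sliceT₃_mem (hS : h.IsAntipode φ S) (hφ : h.IsLeftInvariant φ)
    (hφ0 : φ ≠ 0) (hε : h.IsCounit ε) (θ : h.sliceSpace) (a : A) :
    θ.1 ∘ₗ h.sliceT₃ φ a ∈ dualSubspace φ := by
  set ψ : Module.Dual ℂ A := φ ∘ₗ S.symm.toLinearMap with hψ
  have hψ0 : ψ ≠ 0 := by
    intro h0
    apply hφ0
    ext x
    have := LinearMap.congr_fun h0 (S x)
    simpa [hψ] using this
  have hd := hφ.dualSubspace_eq hφ0 hψ0 (hS.sliceFst_T₄ hφ hφ0 hε)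
  obtain ⟨b, hb⟩ : functionalMul φ a ∈ dualSubspace ψ := hd ▸ ⟨a, rfl⟩
  change functionalMul ψ b = functionalMul φ a at hb
  have e : h.sliceT₃ φ a = h.sliceT₃ ψ b := by
    ext x
    rw [← sub_eq_zero]
    refine h.nondegenerate.right _ fun y => ?_
    rw [mul_sub, mul_sliceT₃, mul_sliceT₃, hb, sub_self]
  rw [e, hd]
  refine ⟨S (h.elemSliceFst θ (S.symm b)), LinearMap.ext fun x => ?_⟩
  change ψ (S (h.elemSliceFst θ (S.symm b)) * x) = θ.1 (h.sliceT₃ ψ b x)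
  obtain ⟨x, rfl⟩ := S.surjective x
  obtain ⟨b, rfl⟩ := S.surjective b
  have e' : h.sliceT₃ ψ (S b) (S x) = h.sliceT₄ φ x b := by
    rw [sliceT₃_apply, hS.T₃_map hφ hφ0 hε, hψ, sliceFst_comm_map, ← hS]
    rfl
  rw [e', ← haar_mul_elemSliceFst, ← hS.map_mul hφ hφ0 hε]
  simp [hψ]

namespace DualAlg

variable {hφ : h.IsLeftInvariant φ}

/-- The element `φ(a ·)` of the dual algebra, linearly in `a`. -/
def ofMul (hφ : h.IsLeftInvariant φ) : A →ₗ[ℂ] h.DualAlg hφ :=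
  (LinearMap.llcomp ℂ A A ℂ φ ∘ₗ LinearMap.mul ℂ A).rangeRestrict

theorem ofMul_surjective : Function.Surjective (ofMul hφ) :=
  LinearMap.surjective_rangeRestrict _

theorem elemSliceSnd_ofMul (a x : A) :
    h.elemSliceSnd (ofMul hφ a).toSliceSpace x = h.sliceT₄ φ a x :=
  elemSliceSnd_eq_sliceT₄ rfl x

theorem elemSliceFst_ofMul (a x : A) :
    h.elemSliceFst (ofMul hφ a).toSliceSpace x = h.sliceT₃ φ a x :=
  elemSliceFst_eq_sliceT₃ rfl x

theorem toFunctional_elemSliceSnd (ω : h.DualAlg hφ) (θ : h.sliceSpace) (x : A) :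
    ω.toFunctional (h.elemSliceSnd θ x) = θ.1 (h.elemSliceFst ω.toSliceSpace x) := by
  obtain ⟨a, rfl⟩ := ofMul_surjective ω
  rw [elemSliceFst_ofMul, ← haar_mul_elemSliceSnd]
  rfl

theorem toFunctional_elemSliceFst (ω : h.DualAlg hφ) (θ : h.sliceSpace) (x : A) :
    ω.toFunctional (h.elemSliceFst θ x) = θ.1 (h.elemSliceSnd ω.toSliceSpace x) := by
  obtain ⟨a, rfl⟩ := ofMul_surjective ω
  rw [elemSliceSnd_ofMul, ← haar_mul_elemSliceFst]
  rfl

theorem elemSliceFst_elemSliceSnd (ω ω' : h.DualAlg hφ) (x : A) :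
    h.elemSliceFst ω.toSliceSpace (h.elemSliceSnd ω'.toSliceSpace x)
      = h.elemSliceSnd ω'.toSliceSpace (h.elemSliceFst ω.toSliceSpace x) := by
  obtain ⟨a, rfl⟩ := ofMul_surjective ω
  obtain ⟨b, rfl⟩ := ofMul_surjective ω'
  simp only [elemSliceSnd_ofMul, elemSliceFst_ofMul, sliceT₃_sliceT₄]

theorem mul_apply' (ω₁ ω₂ : h.DualAlg hφ) (a : A) :
    (ω₁ * ω₂).toFunctional a = ω₂.toFunctional (h.elemSliceFst ω₁.toSliceSpace a) := by
  rw [mul_apply, toFunctional_elemSliceSnd]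
  rfl

protected theorem mul_assoc (ω₁ ω₂ ω₃ : h.DualAlg hφ) : ω₁ * ω₂ * ω₃ = ω₁ * (ω₂ * ω₃) :=
  toFunctional_injective <| LinearMap.ext fun x => by
    rw [mul_apply, mul_apply', mul_apply' ω₁, mul_apply, elemSliceFst_elemSliceSnd]

theorem functional_eq_of_elemSliceSnd (hφ0 : φ ≠ 0) {θ θ' : Module.Dual ℂ A}
    (H : ∀ (ω : h.DualAlg hφ) x,
      θ (h.elemSliceSnd ω.toSliceSpace x) = θ' (h.elemSliceSnd ω.toSliceSpace x)) : θ = θ' := by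
  ext y
  induction y using sliceT₄_span (h := h) hφ0 with
  | zero => simp
  | add x y hx hy => simp only [map_add, hx, hy]
  | slice a x => rw [← elemSliceSnd_ofMul (hφ := hφ), H]

theorem functional_eq_of_elemSliceFst (hφ0 : φ ≠ 0) {θ θ' : Module.Dual ℂ A}
    (H : ∀ (ω : h.DualAlg hφ) x,
      θ (h.elemSliceFst ω.toSliceSpace x) = θ' (h.elemSliceFst ω.toSliceSpace x)) : θ = θ' := by
  ext y
  induction y using sliceT₃_span (h := h) hφ0 with
  | zero => simp
  | add x y hx hy => simp only [map_add, hx, hy]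
  | slice a x => rw [← elemSliceFst_ofMul (hφ := hφ), H]

theorem isNondegenerate (hφ0 : φ ≠ 0) : IsNondegenerate (h.DualAlg hφ) where
  left ω H := toFunctional_injective <| functional_eq_of_elemSliceSnd hφ0 fun ω' x => by
    rw [← mul_apply, H, map_zero]; rfl
  right ω H := toFunctional_injective <| functional_eq_of_elemSliceFst hφ0 fun ω' x => by
    rw [← mul_apply', H, map_zero]; rfl

theorem counit_elemSliceSnd (hε : h.IsCounit ε) (ω : h.DualAlg hφ) (x : A) :
    ε (h.elemSliceSnd ω.toSliceSpace x) = ω.toFunctional x := by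
  obtain ⟨a, rfl⟩ := ofMul_surjective ω
  rw [elemSliceSnd_ofMul, hε.sliceT₄]
  rfl

end DualAlg

/-! ### The isomorphism between the slice space and the multiplier algebra -/

/-- `a ↦ (θ ⊙ ι)Δ(a)`, bilinearly in `θ` and `a`. -/
def elemSliceFstBilin (h : IsRegularMultiplierHopf Δ) : h.sliceSpace →ₗ[ℂ] A →ₗ[ℂ] A :=
  LinearMap.mk₂ ℂ h.elemSliceFst
    (fun θ θ' a => h.nondegenerate.ofElem_injective (by
      rw [map_add, ofElem_elemSliceFst, ofElem_elemSliceFst, ofElem_elemSliceFst]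
      exact h.comulSliceFstBilin.map_add₂ _ _ a))
    (fun c θ a => h.nondegenerate.ofElem_injective (by
      rw [map_smul, ofElem_elemSliceFst, ofElem_elemSliceFst]
      exact h.comulSliceFstBilin.map_smul₂ c _ a))
    (fun θ a b => h.nondegenerate.ofElem_injective (by
      rw [map_add, ofElem_elemSliceFst, ofElem_elemSliceFst, ofElem_elemSliceFst]
      exact (h.comulSliceFstBilin θ.1).map_add a b))
    (fun c θ a => h.nondegenerate.ofElem_injective (by
      rw [map_smul, ofElem_elemSliceFst, ofElem_elemSliceFst]
      exact (h.comulSliceFstBilin _).map_smul c a))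

section Multiplier

theorem IsAntipode.comp_elemSliceSnd_mem (hS : h.IsAntipode φ S) (hφ : h.IsLeftInvariant φ)
    (hφ0 : φ ≠ 0) (hε : h.IsCounit ε) (θ : h.sliceSpace) (ω : h.DualAlg hφ) :
    θ.1 ∘ₗ h.elemSliceSndBilin ω.toSliceSpace ∈ dualSubspace φ := by
  obtain ⟨a, rfl⟩ := DualAlg.ofMul_surjective ω
  have : h.elemSliceSndBilin (DualAlg.ofMul hφ a).toSliceSpace = h.sliceT₄ φ a :=
    LinearMap.ext fun x => DualAlg.elemSliceSnd_ofMul a x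
  rw [this]
  exact hS.comp_sliceT₄_mem hφ hφ0 hε θ a

theorem IsAntipode.comp_elemSliceFst_mem (hS : h.IsAntipode φ S) (hφ : h.IsLeftInvariant φ)
    (hφ0 : φ ≠ 0) (hε : h.IsCounit ε) (θ : h.sliceSpace) (ω : h.DualAlg hφ) :
    θ.1 ∘ₗ h.elemSliceFstBilin ω.toSliceSpace ∈ dualSubspace φ := by
  obtain ⟨a, rfl⟩ := DualAlg.ofMul_surjective ω
  have : h.elemSliceFstBilin (DualAlg.ofMul hφ a).toSliceSpace = h.sliceT₃ φ a :=
    LinearMap.ext fun x => DualAlg.elemSliceFst_ofMul a x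
  rw [this]
  exact hS.comp_sliceT₃_mem hφ hφ0 hε θ a

variable (hφ : h.IsLeftInvariant φ) (hφ0 : φ ≠ 0) (hε : h.IsCounit ε) (hS : h.IsAntipode φ S)

/-- `F(θ)`, the multiplier of the dual algebra given by `ω ↦ θ ω` and `ω ↦ ω θ`. -/
def sliceMultiplier (θ : h.sliceSpace) : MultiplierAlg (h.DualAlg hφ) :=
  MultiplierAlg.mk
    { toFun := fun ω => ⟨_, hS.comp_elemSliceSnd_mem hφ hφ0 hε θ ω⟩
      map_add' := fun ω ω' => DualAlg.toFunctional_injective <| by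
        change θ.1 ∘ₗ h.elemSliceSndBilin _ = θ.1 ∘ₗ _ + θ.1 ∘ₗ _
        rw [map_add, map_add, LinearMap.comp_add]
      map_smul' := fun c ω => DualAlg.toFunctional_injective <| by
        change θ.1 ∘ₗ h.elemSliceSndBilin _ = c • (θ.1 ∘ₗ _)
        rw [map_smul, map_smul, LinearMap.comp_smul] }
    { toFun := fun ω => ⟨_, hS.comp_elemSliceFst_mem hφ hφ0 hε θ ω⟩
      map_add' := fun ω ω' => DualAlg.toFunctional_injective <| by
        change θ.1 ∘ₗ h.elemSliceFstBilin _ = θ.1 ∘ₗ _ + θ.1 ∘ₗ _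
        rw [map_add, map_add, LinearMap.comp_add]
      map_smul' := fun c ω => DualAlg.toFunctional_injective <| by
        change θ.1 ∘ₗ h.elemSliceFstBilin _ = c • (θ.1 ∘ₗ _)
        rw [map_smul, map_smul, LinearMap.comp_smul] }
    (fun ω ω' => DualAlg.toFunctional_injective <| LinearMap.ext fun x => by
      rw [DualAlg.mul_apply, DualAlg.mul_apply']
      change θ.1 (h.elemSliceFst _ _) = θ.1 (h.elemSliceSnd _ _)
      rw [DualAlg.elemSliceFst_elemSliceSnd])

theorem lmul_sliceMultiplier (θ : h.sliceSpace) (ω : h.DualAlg hφ) (x : A) :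
    ((sliceMultiplier hφ hφ0 hε hS θ).lmul ω).toFunctional x
      = θ.1 (h.elemSliceSnd ω.toSliceSpace x) := rfl

theorem rmul_sliceMultiplier (θ : h.sliceSpace) (ω : h.DualAlg hφ) (x : A) :
    ((sliceMultiplier hφ hφ0 hε hS θ).rmul ω).toFunctional x
      = θ.1 (h.elemSliceFst ω.toSliceSpace x) := rfl

/-- `θ ↦ F(θ)` as a linear map. -/
def sliceMultiplierHom : h.sliceSpace →ₗ[ℂ] MultiplierAlg (h.DualAlg hφ) where
  toFun := sliceMultiplier hφ hφ0 hε hS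
  map_add' _ _ := MultiplierAlg.ext' (fun _ => rfl) (fun _ => rfl)
  map_smul' _ _ := MultiplierAlg.ext' (fun _ => rfl) (fun _ => rfl)

theorem sliceMultiplierHom_injective :
    Function.Injective (sliceMultiplierHom hφ hφ0 hε hS) := by
  intro θ θ' H
  refine Subtype.ext <| DualAlg.functional_eq_of_elemSliceSnd (hφ := hφ) hφ0 fun ω x => ?_
  exact congrArg (fun m : MultiplierAlg (h.DualAlg hφ) => (m.lmul ω).toFunctional x) H

/-- A left multiplication `l` by a multiplier of `Â` comes from a functional `θ` on `A`, determined
by `θ((ι ⊙ ω)Δ(x)) = l(ω)(x)`. It is well defined: if `∑ (ι ⊙ ωᵢ)Δ(xᵢ) = 0`, the element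
`y = ∑ (ι ⊙ l(ωᵢ))Δ(xᵢ)` is annihilated by `Â`, since `ω l(ωᵢ) = r(ω) ωᵢ`; hence `y = 0` by
faithfulness, and `ε(y) = ∑ l(ωᵢ)(xᵢ)`. -/
theorem exists_functional_of_multiplier (hφ : h.IsLeftInvariant φ) (hφ0 : φ ≠ 0)
    (hε : h.IsCounit ε) (hS : h.IsAntipode φ S) (m : MultiplierAlg (h.DualAlg hφ)) :
    ∃ θ : Module.Dual ℂ A, ∀ (ω : h.DualAlg hφ) (x : A),
      θ (h.elemSliceSnd ω.toSliceSpace x) = (m.lmul ω).toFunctional x := by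
  let V : A ⊗[ℂ] A →ₗ[ℂ] A := sliceSnd φ ∘ₗ h.T₄
  let W : A ⊗[ℂ] A →ₗ[ℂ] ℂ := TensorProduct.lift
    (DualAlg.toFunctional ∘ₗ m.lmul ∘ₗ DualAlg.ofMul hφ).flip
  let Y : A ⊗[ℂ] A →ₗ[ℂ] A := TensorProduct.lift
    (h.elemSliceSndBilin ∘ₗ DualAlg.toSliceSpace ∘ₗ m.lmul ∘ₗ DualAlg.ofMul hφ).flip
  have hV : Function.Surjective V := (sliceSnd_surjective hφ0).comp h.T₄_bijective.2
  have hεY : ∀ z, ε (Y z) = W z := by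
    intro z
    induction z with
    | zero => simp
    | add u v hu hv => simp only [map_add, hu, hv]
    | tmul x a => exact DualAlg.counit_elemSliceSnd hε _ x
  have hYV : ∀ (b : A) (z : A ⊗[ℂ] A),
      φ (b * Y z) = (m.rmul (DualAlg.ofMul hφ b)).toFunctional (V z) := by
    intro b z
    induction z with
    | zero => simp
    | add u v hu hv => simp only [map_add, mul_add, hu, hv]
    | tmul x a =>
      have := congrArg (fun ω => DualAlg.toFunctional ω x)
        (m.rmul_mul_eq (DualAlg.ofMul hφ b) (DualAlg.ofMul hφ a))
      simp only [DualAlg.mul_apply, DualAlg.elemSliceSnd_ofMul] at this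
      exact this.symm
  have hWV : ∀ z, V z = 0 → W z = 0 := by
    intro z hz
    rw [← hεY, hS.eq_zero_of_haar_mul hφ0 hε (a := Y z), map_zero]
    intro b
    rw [hYV, hz, map_zero]
  obtain ⟨g, hg⟩ := V.exists_rightInverse_of_surjective (LinearMap.range_eq_top.2 hV)
  refine ⟨W ∘ₗ g, fun ω x => ?_⟩
  obtain ⟨a, rfl⟩ := DualAlg.ofMul_surjective ω
  have : W (g (V (x ⊗ₜ a))) = W (x ⊗ₜ a) := by
    rw [← sub_eq_zero, ← map_sub]
    refine hWV _ ?_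
    rw [map_sub, sub_eq_zero]
    exact LinearMap.congr_fun hg _
  rw [DualAlg.elemSliceSnd_ofMul]
  exact this

theorem sliceMultiplierHom_surjective :
    Function.Surjective (sliceMultiplierHom hφ hφ0 hε hS) := by
  intro m
  obtain ⟨θ, hl⟩ := exists_functional_of_multiplier hφ hφ0 hε hS m
  have hr : ∀ (ω : h.DualAlg hφ) (x : A),
      θ (h.elemSliceFst ω.toSliceSpace x) = (m.rmul ω).toFunctional x := by
    intro ω x
    change (θ ∘ₗ h.elemSliceFstBilin ω.toSliceSpace) x = _
    congr 1
    refine DualAlg.functional_eq_of_elemSliceSnd (hφ := hφ) hφ0 fun ω' y => ?_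
    change θ (h.elemSliceFst _ _) = _
    rw [DualAlg.elemSliceFst_elemSliceSnd, hl, ← DualAlg.mul_apply, m.rmul_mul_eq,
      DualAlg.mul_apply']
  have hθ : θ ∈ h.sliceSpace := by
    intro x
    constructor
    · change h.comulSliceFstBilin θ x ∈ _
      induction x using sliceT₃_span (h := h) hφ0 with
      | zero => rw [map_zero]; exact zero_mem _
      | add x y hx hy => rw [map_add]; exact add_mem hx hy
      | slice a x =>
        refine ⟨h.elemSliceFst (m.rmul (DualAlg.ofMul hφ a)).toSliceSpace x,
          h.nondegenerate.multiplier_ext_lmul fun b => ?_⟩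
        rw [ofElem_elemSliceFst]
        change _ = sliceFst θ (h.T₂ (h.sliceT₃ φ a x ⊗ₜ b))
        rw [lmul_comulSliceFst, ← rTensor_sliceT₃_T₂, sliceFst_rTensor]
        congr 2
        ext y
        rw [LinearMap.comp_apply, ← DualAlg.elemSliceFst_ofMul (hφ := hφ), hr]
        rfl
    · change h.comulSliceSndBilin θ x ∈ _
      induction x using sliceT₄_span (h := h) hφ0 with
      | zero => rw [map_zero]; exact zero_mem _
      | add x y hx hy => rw [map_add]; exact add_mem hx hy
      | slice a x =>
        refine ⟨h.elemSliceSnd (m.lmul (DualAlg.ofMul hφ a)).toSliceSpace x,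
          h.nondegenerate.multiplier_ext_rmul fun b => ?_⟩
        rw [ofElem_elemSliceSnd]
        change _ = sliceSnd θ (h.T₃ (h.sliceT₄ φ a x ⊗ₜ b))
        have e := h.lTensor_sliceT₄_T₃ φ a (x ⊗ₜ b)
        rw [LinearMap.rTensor_tmul] at e
        rw [rmul_comulSliceSnd, ← e, sliceSnd_lTensor]
        congr 2
        ext y
        rw [LinearMap.comp_apply, ← DualAlg.elemSliceSnd_ofMul (hφ := hφ), hl]
        rfl
  exact ⟨⟨θ, hθ⟩, MultiplierAlg.ext'
    (fun ω => DualAlg.toFunctional_injective (LinearMap.ext fun x => hl ω x))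
    (fun ω => DualAlg.toFunctional_injective (LinearMap.ext fun x => hr ω x))⟩

/-- The linear isomorphism `F` from the slice space onto the multiplier algebra of `Â`. -/
def sliceSpaceEquiv : h.sliceSpace ≃ₗ[ℂ] MultiplierAlg (h.DualAlg hφ) :=
  LinearEquiv.ofBijective (sliceMultiplierHom hφ hφ0 hε hS)
    ⟨sliceMultiplierHom_injective hφ hφ0 hε hS, sliceMultiplierHom_surjective hφ hφ0 hε hS⟩

theorem elem_eq_of_toFunctional (hφ : h.IsLeftInvariant φ) (hφ0 : φ ≠ 0)
    (hε : h.IsCounit ε) (hS : h.IsAntipode φ S) {a b : A}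
    (hab : ∀ ω : h.DualAlg hφ, ω.toFunctional a = ω.toFunctional b) : a = b := by
  rw [← sub_eq_zero]
  refine hS.eq_zero_of_haar_mul hφ0 hε fun x => ?_
  rw [mul_sub, map_sub, sub_eq_zero]
  exact hab (DualAlg.ofMul hφ x)

theorem elemSliceSnd_lmul_sliceMultiplier (θ : h.sliceSpace) (ω : h.DualAlg hφ) (x : A) :
    h.elemSliceSnd ((sliceMultiplier hφ hφ0 hε hS θ).lmul ω).toSliceSpace x
      = h.elemSliceSnd θ (h.elemSliceSnd ω.toSliceSpace x) := by
  refine elem_eq_of_toFunctional hφ hφ0 hε hS fun ω' => ?_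
  rw [DualAlg.toFunctional_elemSliceSnd, DualAlg.toFunctional_elemSliceSnd,
    DualAlg.elemSliceFst_elemSliceSnd, ← lmul_sliceMultiplier hφ hφ0 hε hS]
  rfl

theorem elemSliceFst_rmul_sliceMultiplier (θ : h.sliceSpace) (ω : h.DualAlg hφ) (x : A) :
    h.elemSliceFst ((sliceMultiplier hφ hφ0 hε hS θ).rmul ω).toSliceSpace x
      = h.elemSliceFst θ (h.elemSliceFst ω.toSliceSpace x) := by
  refine elem_eq_of_toFunctional hφ hφ0 hε hS fun ω' => ?_
  rw [DualAlg.toFunctional_elemSliceFst, DualAlg.toFunctional_elemSliceFst,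
    ← DualAlg.elemSliceFst_elemSliceSnd, ← rmul_sliceMultiplier hφ hφ0 hε hS]
  rfl

theorem sliceSpaceEquiv_symm_mul (θ₁ θ₂ : h.sliceSpace) (a : A) :
    ((sliceSpaceEquiv hφ hφ0 hε hS).symm
        (sliceMultiplier hφ hφ0 hε hS θ₁ * sliceMultiplier hφ hφ0 hε hS θ₂)).1 a
      = θ₁.1 (h.elemSliceSnd θ₂ a) := by
  obtain ⟨θ, hθ⟩ := (sliceSpaceEquiv hφ hφ0 hε hS).surjective
    (sliceMultiplier hφ hφ0 hε hS θ₁ * sliceMultiplier hφ hφ0 hε hS θ₂)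
  rw [← hθ, LinearEquiv.symm_apply_apply]
  change _ = (θ₁.1 ∘ₗ h.elemSliceSndBilin θ₂) a
  congr 1
  refine DualAlg.functional_eq_of_elemSliceSnd (hφ := hφ) hφ0 fun ω x => ?_
  change _ = θ₁.1 (h.elemSliceSnd θ₂ _)
  rw [← elemSliceSnd_lmul_sliceMultiplier hφ hφ0 hε hS]
  exact congrArg (fun m : MultiplierAlg (h.DualAlg hφ) => (m.lmul ω).toFunctional x) hθ

theorem sliceSpaceEquiv_symm_mul' (θ₁ θ₂ : h.sliceSpace) (a : A) :
    ((sliceSpaceEquiv hφ hφ0 hε hS).symm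
        (sliceMultiplier hφ hφ0 hε hS θ₁ * sliceMultiplier hφ hφ0 hε hS θ₂)).1 a
      = θ₂.1 (h.elemSliceFst θ₁ a) := by
  obtain ⟨θ, hθ⟩ := (sliceSpaceEquiv hφ hφ0 hε hS).surjective
    (sliceMultiplier hφ hφ0 hε hS θ₁ * sliceMultiplier hφ hφ0 hε hS θ₂)
  rw [← hθ, LinearEquiv.symm_apply_apply]
  change _ = (θ₂.1 ∘ₗ h.elemSliceFstBilin θ₁) a
  congr 1
  refine DualAlg.functional_eq_of_elemSliceFst (hφ := hφ) hφ0 fun ω x => ?_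
  change _ = θ₂.1 (h.elemSliceFst θ₁ _)
  rw [← elemSliceFst_rmul_sliceMultiplier hφ hφ0 hε hS]
  exact congrArg (fun m : MultiplierAlg (h.DualAlg hφ) => (m.rmul ω).toFunctional x) hθ

theorem sliceSpaceEquiv_symm_one :
    ((sliceSpaceEquiv hφ hφ0 hε hS).symm 1).1 = (ε : A →ₗ[ℂ] ℂ) := by
  obtain ⟨θ, hθ⟩ := (sliceSpaceEquiv hφ hφ0 hε hS).surjective 1
  rw [← hθ, LinearEquiv.symm_apply_apply]
  refine DualAlg.functional_eq_of_elemSliceSnd (hφ := hφ) hφ0 fun ω x => ?_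
  refine Eq.trans ?_ (DualAlg.counit_elemSliceSnd hε ω x).symm
  exact congrArg (fun m : MultiplierAlg (h.DualAlg hφ) => (m.lmul ω).toFunctional x) hθ

end Multiplier

end IsRegularMultiplierHopf

end AlgQuantumGroup

end

theorem mainTheorem1 {A : Type*} [NonUnitalRing A] [Module ℂ A] [IsScalarTower ℂ A A]
    [SMulCommClass ℂ A A] (Δ : A →ₙₐ[ℂ] MultiplierAlg (A ⊗[ℂ] A))
    (h : IsRegularMultiplierHopf Δ)
    (φ : Module.Dual ℂ A) (hφ : h.IsLeftInvariant φ) (hφ0 : φ ≠ 0) :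
    -- the dual `Â` is an associative non-degenerate algebra
    (∀ ω₁ ω₂ ω₃ : h.DualAlg hφ, ω₁ * ω₂ * ω₃ = ω₁ * (ω₂ * ω₃)) ∧
    IsNondegenerate (h.DualAlg hφ) ∧
    -- there is exactly one counit
    (∃! ε : A →ₙₐ[ℂ] ℂ, h.IsCounit ε) ∧
    -- the identification of the slice space with `M(Â)`
    ∃ F : h.sliceSpace ≃ₗ[ℂ] MultiplierAlg (h.DualAlg hφ),
      -- `F(θ) ω = θ ω` and `ω F(θ) = ω θ`, with the natural actions of `Â` on functionals
      (∀ (θ : h.sliceSpace) (ω : h.DualAlg hφ) (x : A),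
        ((F θ).lmul ω).toFunctional x = θ.1 (h.elemSliceSnd ω.toSliceSpace x) ∧
        ((F θ).rmul ω).toFunctional x = θ.1 (h.elemSliceFst ω.toSliceSpace x)) ∧
      -- `F` restricts to the canonical embedding `Â ⊆ M(Â)`
      (∀ ω ω' : h.DualAlg hφ,
        (F ω.toSliceSpace).lmul ω' = ω * ω' ∧ (F ω.toSliceSpace).rmul ω' = ω' * ω) ∧
      -- the product of `M(Â)` in terms of functionals
      (∀ (θ₁ θ₂ : h.sliceSpace) (a : A),
        (F.symm (F θ₁ * F θ₂)).1 a = θ₁.1 (h.elemSliceSnd θ₂ a) ∧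
        (F.symm (F θ₁ * F θ₂)).1 a = θ₂.1 (h.elemSliceFst θ₁ a)) ∧
      -- the counit is the unit of `M(Â)`
      (∀ ε : A →ₙₐ[ℂ] ℂ, h.IsCounit ε → (F.symm 1).1 = (ε : A →ₗ[ℂ] ℂ)) := by
  have hA : ∃ a : A, a ≠ 0 := by
    by_contra! hA
    exact hφ0 (LinearMap.ext fun a => by rw [hA a, map_zero, map_zero])
  obtain ⟨ε, hε⟩ := h.exists_isCounit hA
  obtain ⟨S, hS⟩ := hφ.exists_antipode hφ0 hε
  refine ⟨IsRegularMultiplierHopf.DualAlg.mul_assoc,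
    IsRegularMultiplierHopf.DualAlg.isNondegenerate hφ0,
    ⟨ε, hε, fun ε' hε' => hε.unique hε' hA⟩,
    IsRegularMultiplierHopf.sliceSpaceEquiv hφ hφ0 hε hS,
    fun θ ω x => ⟨rfl, rfl⟩, fun ω ω' => ⟨rfl, ?_⟩, fun θ₁ θ₂ a => ⟨?_, ?_⟩, fun ε' hε' => ?_⟩
  · apply IsRegularMultiplierHopf.DualAlg.toFunctional_injective
    ext x
    rw [IsRegularMultiplierHopf.DualAlg.mul_apply']
    rfl
  · exact IsRegularMultiplierHopf.sliceSpaceEquiv_symm_mul hφ hφ0 hε hS θ₁ θ₂ a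
  · exact IsRegularMultiplierHopf.sliceSpaceEquiv_symm_mul' hφ hφ0 hε hS θ₁ θ₂ a
  · rw [hε.unique hε' hA]
    exact IsRegularMultiplierHopf.sliceSpaceEquiv_symm_one hφ hφ0 hε hS
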